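/- Manifolds are smooth, finite-dimensional, without boundary, and not necessarily connected; a Riemannian manifold $M$ carries a smooth Riemannian metric and its distance function $d_M$ (the infimum of lengths of $C^1$ paths; $d_M=\infty$ between different connected components). For a map $f:M\to N$ between Riemannian manifolds put \[ \mathrm{Lip}(f):=\sup\left\{\frac{d_N(f(x),f(y))}{d_M(x,y)}\;\middle|\;x,y\in M,\ x\neq y\right\}\in[0,\infty], \] where a pair with $d_M(x,y)=\infty$ contributes $0$. The map $f$ is Lipschitz if there is a finite $K\ge 0$ with $d_N(f(x),f(y))\le K\,d_M(x,y)$ for all $x,y\in M$ (with $0\cdot\infty=0$). For a Lipschitz map $F:M\to N$ and $x\in M$, Clarke's generalized differential of $F$ at $x$ is \[ \partial F(x):=\mathrm{Conv}\Big(\Big\{\lim_{i\to\infty}dF_{x_i}\;\Big|\;x_i\to x,\ F\text{ is differentiable at every }x_i,\ \text{the limit exists}\Big\}\Big)\subset\mathrm{Hom}(T_xM,T_{F(x)}N), \] where $\mathrm{Conv}$ denotes the convex hull and the limit is taken in local trivializations of the tangent bundles near $x$ and $F(x)$ (the choice does not matter). The point $x$ is called non-singular for $F$ if every element of $\partial F(x)$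 has maximal rank $\min(\dim M,\dim N)$, and singular otherwise. **Theorem.** Let $F:M\to N$ be a Lipschitz map from a compact Riemannian manifold $M$ into a Riemannian manifold $N$, where $\dim M\le\dim N$. If $F$ has no singular points on $M$, then for every $\eta>0$ there exists a smooth immersion $f_\eta:M\to N$ (that is, a $C^\infty$ map whose differential is injective at every point) such that \[ d_N(F(x),f_\eta(x))<\eta\quad\text{for all }x\in M,\qquad \mathrm{Lip}(f_\eta)\le \mathrm{Lip}(F)\,(1+\eta). \] -/

import Mathlib

open Set Filter Bundle
open scoped Manifold ContDiff Topology ENNReal NNReal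

noncomputable section

section Lipschitz

variable {X Y : Type*} [EMetricSpace X] [EMetricSpace Y]

/-- The Lipschitz constant `Lip(f) = sup { d(f x, f y) / d(x, y) | x ≠ y }`, as an element of
`[0, ∞]`. A pair of points at infinite distance (points of a disconnected manifold that lie in
different connected components) contributes the quotient `0`. -/
def lipschitzConstant (f : X → Y) : ℝ≥0∞ :=
  ⨆ (x : X) (y : X) (_ : x ≠ y), edist (f x) (f y) / edist x y

end Lipschitz

section Clarke

variable {E : Type*} [NormedAddCommGroup E] [NormedSpace ℝ E]
  {E' : Type*} [NormedAddCommGroup E'] [NormedSpace ℝ E']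
  {H : Type*} [TopologicalSpace H] (I : ModelWithCorners ℝ E H)
  {H' : Type*} [TopologicalSpace H'] (J : ModelWithCorners ℝ E' H')
  {M : Type*} [TopologicalSpace M] [ChartedSpace H M] [IsManifold I 1 M]
  {N : Type*} [TopologicalSpace N] [ChartedSpace H' N] [IsManifold J 1 N]

/-- The limits of the differentials `dF` along sequences of points of differentiability of `F` that
converge to `x`. The differentials `dF_{u i} : T_{u i} M → T_{F (u i)} N` at different points are
compared in the trivializations of the two tangent bundles given by the preferred charts at `x` and
at `F x`; over `x` and `F x` themselves these trivializations are the identifications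
`T_x M = E` and `T_{F x} N = E'`, so that a limit is a linear map `T_x M → T_{F x} N`. -/
def limitingDifferentials (F : M → N) (x : M) : Set (E →L[ℝ] E') :=
  {A | ∃ u : ℕ → M, Tendsto u atTop (𝓝 x) ∧ (∀ i, MDifferentiableAt I J F (u i)) ∧
    Tendsto (fun i ↦ inTangentCoordinates I J id F (fun y ↦ mfderiv I J F y) x (u i)) atTop (𝓝 A)}

/-- Clarke's generalized differential `∂F(x)`: the convex hull of all limits of differentials `dF`
at points of differentiability of `F` converging to `x`. -/
def generalizedDifferential (F : M → N) (x : M) : Set (E →L[ℝ] E') :=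
  convexHull ℝ (limitingDifferentials I J F x)

/-- A point `x` is non-singular for `F` (in the sense of Clarke) if every element of `∂F(x)` is of
maximal rank. -/
def IsNonsingularPoint (F : M → N) (x : M) : Prop :=
  ∀ A ∈ generalizedDifferential I J F x,
    Module.finrank ℝ (LinearMap.range (A : E →ₗ[ℝ] E')) =
      min (Module.finrank ℝ E) (Module.finrank ℝ E')

end Clarke

end

/-!
Non-singularity of `F` at `x` means that, in charts, no element of the compact convex set `∂F(x)`
kills a vector `v ≠ 0`. Hence near `x` the increments `F(a + tv) - F(a)` along `v`, together with
all their convex combinations, keep a distance at least `c * t * ‖v‖` from `0`: `F` is *convexly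
expanding*. The Lipschitz bound of `F` also says that its increments lie in certain convex sets,
namely balls of norms, since in small charts the two Riemannian distances differ from fixed norms
by factors close to `1`.

The increments of a mollification are averages of increments of the function, so both conditions
survive mollification in a chart. Compactness leaves finitely many charts to treat one after
another, each step costing an arbitrarily small error. The resulting smooth map is an immersion
because it is convexly expanding, and integrating its local Lipschitz bound along paths bounds its
global Lipschitz constant. This needs room between `Lip F` and `Lip F * (1 + η)`; if `Lip F = 0`,
then `M` is discrete and `F` itself is the required immersion.
-/

section

open MeasureTheory Metric Manifold

section Mollification

variable {E : Type*} [NormedAddCommGroup E] [NormedSpace ℝ E]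
  [MeasurableSpace E] [BorelSpace E]
  {E' : Type*} [NormedAddCommGroup E'] [NormedSpace ℝ E']

/-- The measure whose density with respect to `ν` is the bump function `φ`, normalized to have
integral `1`. -/
noncomputable def bumpMeasure [HasContDiffBump E] (φ : ContDiffBump (0 : E)) (ν : Measure E) :
    Measure E :=
  ν.withDensity fun w ↦ ENNReal.ofReal (φ.normed ν w)

/-- The mollification of `g` by the bump function `φ`, written as an average of translates of `g`
over a probability measure, so that it inherits every closed convex constraint on `g`. -/
noncomputable def mollify [HasContDiffBump E] (φ : ContDiffBump (0 : E)) (ν : Measure E)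
    (g : E → E') (y : E) : E' :=
  ∫ w, g (y - w) ∂bumpMeasure φ ν

variable [FiniteDimensional ℝ E] (φ : ContDiffBump (0 : E)) (ν : Measure E)

theorem measurable_ofReal_normed : Measurable fun w ↦ ENNReal.ofReal (φ.normed ν w) :=
  φ.continuous_normed.measurable.ennreal_ofReal

theorem mollify_eq_convolution (g : E → E') :
    mollify φ ν g = convolution (φ.normed ν) g (ContinuousLinearMap.lsmul ℝ ℝ) ν := by
  ext y
  rw [mollify, bumpMeasure, integral_withDensity_eq_integral_toReal_smul
    (measurable_ofReal_normed φ ν) (by simp)]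
  simp only [ENNReal.toReal_ofReal (φ.nonneg_normed _)]
  rfl

variable [ν.IsAddHaarMeasure]

instance isProbabilityMeasure_bumpMeasure : IsProbabilityMeasure (bumpMeasure φ ν) where
  measure_univ := by
    rw [bumpMeasure, withDensity_apply _ MeasurableSet.univ, Measure.restrict_univ,
      ← ofReal_integral_eq_lintegral_ofReal φ.integrable_normed
        (Eventually.of_forall φ.nonneg_normed), φ.integral_normed, ENNReal.ofReal_one]

theorem ae_bumpMeasure_mem_ball : ∀ᵐ w ∂bumpMeasure φ ν, w ∈ ball (0 : E) φ.rOut := by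
  rw [bumpMeasure, ae_withDensity_iff (measurable_ofReal_normed φ ν)]
  refine Eventually.of_forall fun w hw ↦ ?_
  rw [← φ.support_normed_eq (μ := ν), Function.mem_support]
  exact fun h ↦ hw (by rw [h, ENNReal.ofReal_zero])

variable {φ ν} {g : E → E'}

theorem integrable_bumpMeasure_comp_sub_left (hg : LocallyIntegrable g ν) (y : E) :
    Integrable (fun w ↦ g (y - w)) (bumpMeasure φ ν) := by
  rw [bumpMeasure, integrable_withDensity_iff_integrable_smul' (measurable_ofReal_normed φ ν)
    (by simp)]
  simp only [ENNReal.toReal_ofReal (φ.nonneg_normed _)]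
  exact φ.hasCompactSupport_normed.convolutionExists_left (ContinuousLinearMap.lsmul ℝ ℝ)
    φ.continuous_normed hg y

theorem contDiff_mollify (hg : LocallyIntegrable g ν) : ContDiff ℝ ∞ (mollify φ ν g) := by
  rw [mollify_eq_convolution]
  exact φ.hasCompactSupport_normed.contDiff_convolution_left (n := ⊤)
    (ContinuousLinearMap.lsmul ℝ ℝ) φ.contDiff_normed hg

theorem mollify_mem [CompleteSpace E'] (hg : LocallyIntegrable g ν) {S : Set E'}
    (hS : Convex ℝ S) (hSc : IsClosed S) {y : E} (hgS : ∀ z ∈ ball y φ.rOut, g z ∈ S) :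
    mollify φ ν g y ∈ S := by
  refine hS.integral_mem hSc ?_ (integrable_bumpMeasure_comp_sub_left hg y)
  filter_upwards [ae_bumpMeasure_mem_ball φ ν] with w hw
  exact hgS _ (by simpa [mem_ball, dist_eq_norm] using hw)

theorem mollify_sub_mem [CompleteSpace E'] (hg : LocallyIntegrable g ν) {S : Set E'}
    (hS : Convex ℝ S) (hSc : IsClosed S) {y z : E}
    (hgS : ∀ w ∈ ball (0 : E) φ.rOut, g (z - w) - g (y - w) ∈ S) :
    mollify φ ν g z - mollify φ ν g y ∈ S := by
  have hy := integrable_bumpMeasure_comp_sub_left (φ := φ) hg y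
  have hz := integrable_bumpMeasure_comp_sub_left (φ := φ) hg z
  rw [mollify, mollify, ← integral_sub hz hy]
  refine hS.integral_mem hSc ?_ (hz.sub hy)
  filter_upwards [ae_bumpMeasure_mem_ball φ ν] with w hw using hgS w hw

end Mollification

section LocalSmoothing

/-- The interpolation `g + b • (h - g)` turns the increment of `g` into a convex combination of the
increments of `g` and `h`, up to the error `(b z - b y) • (h y - g y)`. -/
theorem exists_mem_norm_sub_le_of_convex {E E' : Type*} [SeminormedAddCommGroup E]
    [SeminormedAddCommGroup E'] [NormedSpace ℝ E'] {g h : E → E'} {b : E → ℝ} {Λ : ℝ≥0}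
    (hb : LipschitzWith Λ b) {y z : E} (hbz : b z ∈ Icc (0 : ℝ) 1) {S : Set E'} (hS : Convex ℝ S)
    (hgS : g z - g y ∈ S) (hhS : h z - h y ∈ S) :
    ∃ u ∈ S, ‖(g z + b z • (h z - g z)) - (g y + b y • (h y - g y)) - u‖ ≤
      Λ * ‖h y - g y‖ * ‖z - y‖ := by
  refine ⟨(1 - b z) • (g z - g y) + b z • (h z - h y),
    hS hgS hhS (by linarith [hbz.2]) hbz.1 (by ring), ?_⟩
  have herr : (g z + b z • (h z - g z)) - (g y + b y • (h y - g y)) -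
      ((1 - b z) • (g z - g y) + b z • (h z - h y)) = (b z - b y) • (h y - g y) := by
    module
  rw [herr, norm_smul, mul_right_comm]
  gcongr
  simpa [dist_eq_norm] using hb.dist_le_mul z y

/-- Up to an error of at most `δ` times the step, every increment of `h` is an average of the
increments of `g` between translates of the endpoints by less than `ρ`, all taken inside `U`. This
is expressed by closed convex constraints: those satisfied by these increments of `g` hold for the
increment of `h` up to the error. -/
def IsIncrementAverage {E E' : Type*} [SeminormedAddCommGroup E] [SeminormedAddCommGroup E']
    [Module ℝ E'] (g h : E → E') (U : Set E) (ρ δ : ℝ) : Prop :=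
  ∀ S : Set E', Convex ℝ S → IsClosed S → ∀ y z, ball y ρ ⊆ U → ball z ρ ⊆ U →
    (∀ w ∈ ball (0 : E) ρ, g (z - w) - g (y - w) ∈ S) → ∃ u ∈ S, ‖h z - h y - u‖ ≤ δ * ‖z - y‖

theorem IsIncrementAverage.mono {E E' : Type*} [SeminormedAddCommGroup E]
    [SeminormedAddCommGroup E'] [Module ℝ E'] {g h : E → E'} {U : Set E} {ρ ρ' δ δ' : ℝ}
    (hgh : IsIncrementAverage g h U ρ δ) (hρ : ρ ≤ ρ') (hδ : δ ≤ δ') :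
    IsIncrementAverage g h U ρ' δ' := by
  intro S hS hSc y z hy hz hgS
  obtain ⟨u, hu, hhu⟩ := hgh S hS hSc y z ((ball_subset_ball hρ).trans hy)
    ((ball_subset_ball hρ).trans hz) fun w hw ↦ hgS w (ball_subset_ball hρ hw)
  exact ⟨u, hu, hhu.trans (by gcongr)⟩

variable {E : Type*} [NormedAddCommGroup E] [NormedSpace ℝ E] [FiniteDimensional ℝ E]
  {E' : Type*} [NormedAddCommGroup E'] [NormedSpace ℝ E'] [CompleteSpace E']

theorem exists_contDiff_approx_of_isCompact {g : E → E'} {s : Set E} (hs : IsCompact s)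
    (hg : ContinuousOn g s) {ρ δ : ℝ} (hρ : 0 < ρ) (hδ : 0 < δ) :
    ∃ h : E → E', ContDiff ℝ ∞ h ∧ (∀ y, ball y ρ ⊆ s → ‖h y - g y‖ ≤ δ) ∧
      ∀ S : Set E', Convex ℝ S → IsClosed S → ∀ y z, ball y ρ ⊆ s → ball z ρ ⊆ s →
        (∀ w ∈ ball (0 : E) ρ, g (z - w) - g (y - w) ∈ S) → h z - h y ∈ S := by
  borelize E
  obtain ⟨ε₀, hε₀, hgε₀⟩ :=
    Metric.uniformContinuousOn_iff.1 (hs.uniformContinuousOn_of_continuous hg) δ hδ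
  let φ : ContDiffBump (0 : E) :=
    ⟨min ρ ε₀ / 2, min ρ ε₀, by positivity, half_lt_self (by positivity)⟩
  have hball : ∀ y : E, ball y φ.rOut ⊆ ball y ρ := fun y ↦ ball_subset_ball (min_le_left _ _)
  have hgs : LocallyIntegrable (s.indicator g) (Measure.addHaar : Measure E) :=
    ((hg.integrableOn_compact hs).integrable_indicator hs.measurableSet).locallyIntegrable
  refine ⟨mollify φ Measure.addHaar (s.indicator g), contDiff_mollify hgs, fun y hy ↦ ?_,
    fun S hS hSc y z hy hz hgS ↦ mollify_sub_mem hgs hS hSc fun w hw ↦ ?_⟩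
  · rw [← mem_closedBall_iff_norm]
    refine mollify_mem hgs (convex_closedBall _ _) isClosed_closedBall fun z hz ↦ ?_
    have hzs : z ∈ s := hy (hball y hz)
    rw [indicator_of_mem hzs]
    exact (hgε₀ z hzs y (hy (mem_ball_self hρ)) (hz.trans_le (min_le_right _ _))).le
  · have hsub : ∀ x, ball x ρ ⊆ s → x - w ∈ s := fun x hx ↦
      hx (hball x (by simpa [mem_ball, dist_eq_norm] using hw))
    rw [indicator_of_mem (hsub z hz), indicator_of_mem (hsub y hy)]
    exact hgS w (hball 0 hw)

theorem exists_local_smoothing {g : E → E'} {a : E} {R : ℝ} (hR : 0 < R)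
    (hg : ContinuousOn g (closedBall a R)) {ρ δ : ℝ} (hρ : 0 < ρ) (hρR : ρ ≤ R / 2)
    (hδ : 0 < δ) :
    ∃ h : E → E', (∀ y ∉ closedBall a (R / 2), h y = g y) ∧
      (∀ y, ‖h y - g y‖ ≤ δ) ∧
      (∀ y ∈ ball a (R / 4), ContDiffAt ℝ ∞ h y) ∧
      (∀ y, ContDiffAt ℝ ∞ g y → ContDiffAt ℝ ∞ h y) ∧
      IsIncrementAverage g h (closedBall a R) ρ δ := by
  let b : ContDiffBump a := ⟨R / 4, R / 2, by positivity, by linarith⟩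
  obtain ⟨Λ, hΛ⟩ := (b.contDiff (n := ⊤)).lipschitzWith_of_hasCompactSupport b.hasCompactSupport
    (by simp)
  obtain ⟨ε, hε, hΛε⟩ := exists_pos_mul_lt hδ (Λ : ℝ)
  obtain ⟨k, hk, hkg, hkS⟩ := exists_contDiff_approx_of_isCompact (isCompact_closedBall a R) hg hρ
    (lt_min hδ hε)
  have hb0 : ∀ y ∉ closedBall a (R / 2), b y = 0 := fun y hy ↦
    b.zero_of_le_dist (by simpa using (not_le.1 (mem_closedBall.not.1 hy)).le)
  refine ⟨fun y ↦ g y + b y • (k y - g y), fun y hy ↦ by simp [hb0 y hy], fun y ↦ ?_,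
    fun y hy ↦ ?_, fun y hy ↦ hy.add (b.contDiff.contDiffAt.smul (hk.contDiffAt.sub hy)),
    fun S hS hSc y z hy hz hgS ↦ ?_⟩
  · by_cases hy : y ∈ closedBall a (R / 2)
    · have hyR : ball y ρ ⊆ closedBall a R := ball_subset_closedBall.trans
        (closedBall_subset_closedBall' (by linarith [mem_closedBall.1 hy]))
      rw [add_sub_cancel_left, norm_smul, Real.norm_of_nonneg b.nonneg]
      exact (mul_le_of_le_one_left (norm_nonneg _) b.le_one).trans
        ((hkg y hyR).trans (min_le_left _ _))
    · simp [hb0 y hy, hδ.le]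
  · refine hk.contDiffAt.congr_of_eventuallyEq ?_
    filter_upwards [isOpen_ball.mem_nhds hy] with w hw
    simp [b.one_of_mem_closedBall (ball_subset_closedBall hw)]
  · obtain ⟨u, huS, hu⟩ := exists_mem_norm_sub_le_of_convex (g := g) (h := k) hΛ
      ⟨b.nonneg, b.le_one⟩ hS (by simpa using hgS 0 (mem_ball_self hρ)) (hkS S hS hSc y z hy hz hgS)
    refine ⟨u, huS, hu.trans ?_⟩
    gcongr
    calc Λ * ‖k y - g y‖ ≤ Λ * ε := by
          gcongr
          exact (hkg y hy).trans (min_le_right _ _)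
      _ ≤ δ := hΛε.le

end LocalSmoothing

section ConvexlyExpanding

variable {E : Type*} [NormedAddCommGroup E]
  {E' : Type*} [NormedAddCommGroup E'] [NormedSpace ℝ E']

/-- Near `a`, the closed convex hull of the increments of `g` along any vector `v` stays at
distance at least `c * ‖v‖` from the origin. By the Hahn-Banach theorem this is expressed through a
functional of norm at most one; it is the form of injectivity of the differential which makes sense
for a nonsmooth map and survives averaging. -/
def ConvexlyExpandingAt (g : E → E') (a : E) : Prop :=
  ∃ c > 0, ∃ s ∈ 𝓝 a, ∀ v : E, ∃ l : E' →L[ℝ] ℝ, ‖l‖ ≤ 1 ∧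
    ∀ y ∈ s, y + v ∈ s → c * ‖v‖ ≤ l (g (y + v) - g y)

theorem convexlyExpandingAt_of_norm_le {g : E → E'} {a : E} {c C : ℝ} (hc : 0 < c) {s : Set E}
    (hs : s ∈ 𝓝 a) (h : ∀ v : E, ∃ l : E' →L[ℝ] ℝ, ‖l‖ ≤ C ∧
      ∀ y ∈ s, y + v ∈ s → c * ‖v‖ ≤ l (g (y + v) - g y)) : ConvexlyExpandingAt g a := by
  have hC : 0 < max C 1 := lt_max_of_lt_right one_pos
  refine ⟨(max C 1)⁻¹ * c, by positivity, s, hs, fun v ↦ ?_⟩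
  obtain ⟨l, hl, hlg⟩ := h v
  refine ⟨(max C 1)⁻¹ • l, ?_, fun y hy hyv ↦ ?_⟩
  · rw [norm_smul, norm_inv, Real.norm_of_nonneg hC.le, inv_mul_le_one₀ hC]
    exact hl.trans (le_max_left _ _)
  · rw [_root_.smul_apply, smul_eq_mul, mul_assoc]
    gcongr
    exact hlg y hy hyv

namespace ConvexlyExpandingAt

variable {g g' : E → E'} {a : E}

theorem congr (h : ConvexlyExpandingAt g a) (hg : g' =ᶠ[𝓝 a] g) : ConvexlyExpandingAt g' a := by
  obtain ⟨c, hc, s, hs, H⟩ := h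
  refine ⟨c, hc, _, inter_mem hs hg, fun v ↦ ?_⟩
  obtain ⟨l, hl, hlg⟩ := H v
  refine ⟨l, hl, fun y hy hyv ↦ ?_⟩
  rw [hy.2, hyv.2]
  exact hlg y hy.1 hyv.1

theorem eventually_norm_le_norm_sub (h : ConvexlyExpandingAt g a) :
    ∃ c > 0, ∀ᶠ y in 𝓝 a, c * ‖y - a‖ ≤ ‖g y - g a‖ := by
  obtain ⟨c, hc, s, hs, H⟩ := h
  refine ⟨c, hc, mem_of_superset hs fun y hy ↦ ?_⟩
  obtain ⟨l, hl, hlg⟩ := H (y - a)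
  calc c * ‖y - a‖ ≤ l (g y - g a) := by
        simpa using hlg a (mem_of_mem_nhds hs) (by simpa using hy)
    _ ≤ ‖g y - g a‖ :=
        (Real.le_norm_self _).trans ((l.le_of_opNorm_le hl _).trans_eq (one_mul _))

theorem comp_left {F' : Type*} [NormedAddCommGroup F'] [NormedSpace ℝ F'] {σ : E' → F'}
    {T : E' ≃L[ℝ] F'} (h : ConvexlyExpandingAt g a) {K : ℝ≥0} {U : Set E} (hU : U ∈ 𝓝 a)
    (hg : LipschitzOnWith K g U) (hσ : HasStrictFDerivAt σ (T : E' →L[ℝ] F') (g a)) :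
    ConvexlyExpandingAt (σ ∘ g) a := by
  obtain ⟨c, hc, s, hs, H⟩ := h
  set T' : F' →L[ℝ] E' := (T.symm : F' →L[ℝ] E')
  obtain ⟨ε, hε, hKε⟩ := exists_pos_mul_lt hc (‖T'‖ * K)
  have hlin : ∀ᶠ q : E' × E' in 𝓝 (g a, g a),
      ‖σ q.1 - σ q.2 - T (q.1 - q.2)‖ ≤ ε * ‖q.1 - q.2‖ :=
    (hasStrictFDerivAt_iff_isLittleO.1 hσ).def hε
  rw [nhds_prod_eq] at hlin
  obtain ⟨V, hV, hVσ⟩ := eventually_prod_self_iff'.1 hlin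
  have hgV : g ⁻¹' V ∈ 𝓝 a := (hg.continuousOn.continuousAt hU).preimage_mem_nhds hV
  refine convexlyExpandingAt_of_norm_le (sub_pos.2 hKε) (inter_mem hs (inter_mem hU hgV))
    (C := ‖T'‖) fun v ↦ ?_
  obtain ⟨l, hl, hlg⟩ := H v
  have hlT : ‖l ∘L T'‖ ≤ ‖T'‖ :=
    (l.opNorm_comp_le T').trans (mul_le_of_le_one_left (norm_nonneg _) hl)
  refine ⟨l ∘L T', hlT, fun y ⟨hys, hyU, hyV⟩ ⟨hyvs, hyvU, hyvV⟩ ↦ ?_⟩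
  set e := σ (g (y + v)) - σ (g y) - T (g (y + v) - g y) with he
  have heq : σ (g (y + v)) - σ (g y) = T (g (y + v) - g y) + e := by rw [he]; abel
  have hgK : ‖g (y + v) - g y‖ ≤ K * ‖v‖ := by
    simpa [dist_eq_norm] using hg.dist_le_mul _ hyvU _ hyU
  have hle : |l (T' e)| ≤ ‖T'‖ * (ε * (K * ‖v‖)) := calc
    |l (T' e)| ≤ ‖T'‖ * ‖e‖ := (l ∘L T').le_of_opNorm_le hlT e
    _ ≤ ‖T'‖ * (ε * (K * ‖v‖)) := by
      gcongr
      exact (hVσ _ hyvV _ hyV).trans (by gcongr)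
  have hTT' : T' (T (g (y + v) - g y)) = g (y + v) - g y := T.symm_apply_apply _
  simp only [Function.comp_apply, heq, ContinuousLinearMap.comp_apply, map_add, hTT']
  linarith [(abs_le.1 hle).1, hlg y hys hyvs]

variable [NormedSpace ℝ E]

theorem fderiv_injective (h : ConvexlyExpandingAt g a) {A : E →L[ℝ] E'}
    (hA : HasFDerivAt g A a) : Function.Injective A := by
  obtain ⟨c, hc, hcg⟩ := h.eventually_norm_le_norm_sub
  refine (injective_iff_map_eq_zero _).2 fun v hv ↦ ?_
  have hslope : Tendsto (fun t : ℝ ↦ ‖t⁻¹ • (g (a + t • v) - g a)‖) (𝓝[>] 0) (𝓝 ‖A v‖) :=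
    ((hA.hasLineDerivAt v).tendsto_slope_zero_right).norm
  have htv : Tendsto (fun t : ℝ ↦ a + t • v) (𝓝[>] 0) (𝓝 a) :=
    (Continuous.tendsto' (by fun_prop) _ _ (by simp)).mono_left nhdsWithin_le_nhds
  have hle : c * ‖v‖ ≤ ‖A v‖ := by
    refine ge_of_tendsto hslope ?_
    filter_upwards [htv.eventually hcg, self_mem_nhdsWithin] with t ht (ht0 : 0 < t)
    rw [add_sub_cancel_left, norm_smul, Real.norm_of_nonneg ht0.le] at ht
    rw [norm_smul, norm_inv, Real.norm_of_nonneg ht0.le, le_inv_mul_iff₀ ht0]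
    linarith
  rw [hv, norm_zero] at hle
  exact norm_le_zero_iff.1 (nonpos_of_mul_nonpos_right hle hc)

theorem comp_right {F : Type*} [NormedAddCommGroup F] [NormedSpace ℝ F] {τ : F → E} {b : F}
    {T : F ≃L[ℝ] E} (h : ConvexlyExpandingAt g (τ b)) {K : ℝ≥0} {U : Set E} (hU : U ∈ 𝓝 (τ b))
    (hg : LipschitzOnWith K g U) (hτ : HasStrictFDerivAt τ (T : F →L[ℝ] E) b) :
    ConvexlyExpandingAt (g ∘ τ) b := by
  obtain ⟨c, hc, s, hs, H⟩ := h
  obtain ⟨C, hC, hTC⟩ := (T.symm : E →L[ℝ] F).bound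
  obtain ⟨ε, hε, hKε⟩ := exists_pos_mul_lt (div_pos hc hC) (K : ℝ)
  have hsU : s ∩ U ∈ 𝓝 (τ b) := inter_mem hs hU
  have hlin : ∀ᶠ q : F × F in 𝓝 (b, b), ‖τ q.1 - τ q.2 - T (q.1 - q.2)‖ ≤ ε * ‖q.1 - q.2‖ :=
    (hasStrictFDerivAt_iff_isLittleO.1 hτ).def hε
  have hτmem : ∀ᶠ q : F × F in 𝓝 (b, b), τ q.2 + T (q.1 - q.2) ∈ s ∩ U := by
    have hcont : ContinuousAt (fun q : F × F ↦ τ q.2 + T (q.1 - q.2)) (b, b) :=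
      (hτ.continuousAt.comp (x := (b, b)) continuousAt_snd).add
        (T.continuous.comp (continuous_fst.sub continuous_snd)).continuousAt
    exact hcont.preimage_mem_nhds (by simpa using hsU)
  have hnhds := hlin.and hτmem
  rw [nhds_prod_eq] at hnhds
  obtain ⟨V, hV, hVτ⟩ := eventually_prod_self_iff'.1 hnhds
  refine ⟨c / C - K * ε, sub_pos.2 hKε, _,
    inter_mem hV (hτ.continuousAt.preimage_mem_nhds hsU), fun v ↦ ?_⟩
  obtain ⟨l, hl, hlg⟩ := H (T v)
  refine ⟨l, hl, fun y hy hyv ↦ ?_⟩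
  obtain ⟨hτv, hTmem⟩ := hVτ _ hyv.1 _ hy.1
  simp only [add_sub_cancel_left] at hτv hTmem
  have hgap : l (g (τ y + T v) - g (τ (y + v))) ≤ K * (ε * ‖v‖) := calc
    _ ≤ ‖g (τ y + T v) - g (τ (y + v))‖ :=
      (Real.le_norm_self _).trans ((l.le_of_opNorm_le hl _).trans_eq (one_mul _))
    _ ≤ K * ‖τ y + T v - τ (y + v)‖ := by
      simpa only [dist_eq_norm] using hg.dist_le_mul _ hTmem.2 _ hyv.2.2
    _ ≤ K * (ε * ‖v‖) := by
      gcongr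
      rwa [norm_sub_rev, ← sub_sub]
  have hv : c / C * ‖v‖ ≤ c * ‖T v‖ := by
    rw [div_mul_eq_mul_div, div_le_iff₀ hC, mul_assoc, mul_comm ‖T v‖]
    gcongr
    simpa using hTC (T v)
  have hincr := hlg (τ y) hy.2.1 hTmem.1
  simp only [Function.comp_apply, map_sub] at hincr hgap ⊢
  linarith

end ConvexlyExpandingAt

end ConvexlyExpanding

section Convexity

theorem isCompact_convexHull {E : Type*} [AddCommGroup E] [Module ℝ E] [FiniteDimensional ℝ E]
    [TopologicalSpace E] [ContinuousAdd E] [ContinuousSMul ℝ E] {s : Set E} (hs : IsCompact s) :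
    IsCompact (convexHull ℝ s) := by
  let Φ (k : ℕ) (q : (Fin k → ℝ) × (Fin k → E)) : E := ∑ i, q.1 i • q.2 i
  let P (k : ℕ) : Set ((Fin k → ℝ) × (Fin k → E)) := stdSimplex ℝ (Fin k) ×ˢ univ.pi fun _ ↦ s
  suffices h : convexHull ℝ s = ⋃ k ∈ Iic (Module.finrank ℝ E + 1), Φ k '' P k by
    rw [h]
    exact (finite_Iic _).isCompact_biUnion fun k _ ↦
      ((isCompact_stdSimplex ℝ (Fin k)).prod (isCompact_univ_pi fun _ ↦ hs)).image
        (by fun_prop)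
  refine Subset.antisymm (fun x hx ↦ ?_) (iUnion₂_subset fun k _ ↦ ?_)
  · obtain ⟨ι, hι, z, w, hz, hind, hw, hw1, rfl⟩ := eq_pos_convex_span_of_mem_convexHull hx
    let e := (Fintype.equivFin ι).symm
    refine mem_biUnion (x := Fintype.card ι) (hind.card_le_finrank_succ.trans
      (Nat.succ_le_succ (Submodule.finrank_le _))) ⟨(w ∘ e, z ∘ e), ⟨⟨fun i ↦ (hw _).le, ?_⟩,
        fun i _ ↦ hz (mem_range_self _)⟩, e.sum_comp fun i ↦ w i • z i⟩
    exact (e.sum_comp w).trans hw1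
  · rintro _ ⟨⟨w, z⟩, ⟨hw, hz⟩, rfl⟩
    exact (convex_convexHull ℝ s).sum_mem (fun i _ ↦ hw.1 i) hw.2
      fun i _ ↦ subset_convexHull ℝ s (hz i (mem_univ i))

theorem exists_forall_le_apply_of_convex {E : Type*} [NormedAddCommGroup E] [NormedSpace ℝ E]
    {s : Set E} (hs : Convex ℝ s) {c : ℝ} (hc : ∀ w ∈ s, c ≤ ‖w‖) :
    ∃ l : E →L[ℝ] ℝ, ‖l‖ ≤ 1 ∧ ∀ w ∈ s, c ≤ l w := by
  rcases le_or_gt c 0 with hc0 | hc0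
  · exact ⟨0, by simp, fun w _ ↦ by simpa using hc0⟩
  have hdisj : Disjoint (ball 0 c) s := disjoint_left.2 fun w hwc hws ↦
    (hc w hws).not_gt (mem_ball_zero_iff.1 hwc)
  obtain ⟨f, u, hfu, huf⟩ := geometric_hahn_banach_open (convex_ball 0 c) isOpen_ball hs hdisj
  have hu : 0 < u := by simpa using hfu 0 (mem_ball_self hc0)
  have hball : closedBall 0 c ⊆ {w | ‖f w‖ ≤ u} := by
    rw [← closure_ball 0 hc0.ne']
    refine closure_minimal (fun w hw ↦ abs_le.2 ⟨?_, (hfu w hw).le⟩)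
      (isClosed_le (by fun_prop) continuous_const)
    have := hfu (-w) (by simpa using hw)
    rw [map_neg] at this
    linarith
  have hf : ‖f‖ ≤ u / c := f.opNorm_bound_of_ball_bound hc0 u hball
  refine ⟨(c / u) • f, ?_, fun w hw ↦ ?_⟩
  · rw [norm_smul, Real.norm_of_nonneg (by positivity)]
    calc c / u * ‖f‖ ≤ c / u * (u / c) := by gcongr
      _ = 1 := by field_simp
  · rw [_root_.smul_apply, smul_eq_mul, div_mul_eq_mul_div, le_div_iff₀ hu]
    gcongr
    exact huf w hw

end Convexity

section ClarkeDifferential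

variable {E : Type*} [NormedAddCommGroup E] [NormedSpace ℝ E]

section LowerBound

variable {h : E → ℝ} {K : ℝ≥0} {s : Set E} {c : ℝ} {v : E}

theorem le_sub_of_ae_segment_le_fderiv (hh : LipschitzOnWith K h s) (hsc : Convex ℝ s) {y : E}
    (hy : y ∈ s) (hyv : y + v ∈ s)
    (hc : ∀ᵐ t : ℝ, y + t • v ∈ s → DifferentiableAt ℝ h (y + t • v) ∧
      c ≤ fderiv ℝ h (y + t • v) v) : c ≤ h (y + v) - h y := by
  have hmaps : MapsTo (fun t : ℝ ↦ y + t • v) (uIcc 0 1) s := by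
    rw [uIcc_of_le zero_le_one]
    exact fun t ht ↦ hsc.add_smul_mem hy hyv ht
  have hline : LipschitzWith ‖v‖₊ fun t : ℝ ↦ y + t • v :=
    LipschitzWith.of_dist_le_mul fun t t' ↦ by
      simp [dist_eq_norm, ← sub_smul, norm_smul, mul_comm]
  have hac : AbsolutelyContinuousOnInterval (fun t : ℝ ↦ h (y + t • v)) 0 1 :=
    (hh.comp hline.lipschitzOnWith hmaps).absolutelyContinuousOnInterval
  calc c = ∫ _ in (0 : ℝ)..1, c := by simp
    _ ≤ ∫ t in (0 : ℝ)..1, deriv (fun t : ℝ ↦ h (y + t • v)) t := by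
      refine intervalIntegral.integral_mono_ae_restrict zero_le_one intervalIntegrable_const
        hac.intervalIntegrable_deriv ?_
      filter_upwards [ae_restrict_mem measurableSet_Icc, ae_restrict_of_ae hc] with t ht htc
      obtain ⟨hdiff, hle⟩ := htc (hmaps (by rwa [uIcc_of_le zero_le_one]))
      have hder : HasDerivAt (fun t : ℝ ↦ y + t • v) v t := by
        simpa using ((hasDerivAt_id t).smul_const v).const_add y
      exact hle.trans_eq (hdiff.hasFDerivAt.comp_hasDerivAt t hder).deriv.symm
    _ = h (y + v) - h y := by simpa using hac.integral_deriv_eq_sub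

variable [FiniteDimensional ℝ E] [MeasurableSpace E] [BorelSpace E] {ν : Measure E}
  [ν.IsAddHaarMeasure]

/-- By Fubini's theorem the bound holds along almost every segment parallel to `v`, hence along all
of them by continuity. -/
theorem le_sub_of_ae_le_fderiv (hh : LipschitzOnWith K h s) (hso : IsOpen s) (hsc : Convex ℝ s)
    (hc : ∀ᵐ y ∂ν, y ∈ s → c ≤ fderiv ℝ h y v) {y : E} (hy : y ∈ s) (hyv : y + v ∈ s) :
    c ≤ h (y + v) - h y := by
  set P := {z | z ∈ s → DifferentiableAt ℝ h z ∧ c ≤ fderiv ℝ h z v}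
  have hP : MeasurableSet P := hso.measurableSet.imp ((measurableSet_of_differentiableAt ℝ h).inter
    (measurableSet_le measurable_const (measurable_fderiv_apply_const ℝ h v)))
  have hPae : ∀ᵐ z ∂ν, z ∈ P := by
    filter_upwards [hc, hh.ae_differentiableWithinAt_of_mem] with z hz hdiff hzs
    exact ⟨(hdiff hzs).differentiableAt (hso.mem_nhds hzs), hz hzs⟩
  have hlines : Dense {z | ∀ᵐ t : ℝ, z + t • v ∈ P} := Measure.dense_of_ae
    ((ae_ae_add_linearMap_mem_iff (LinearMap.toSpanSingleton ℝ E v) volume ν hP).2 hPae)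
  have hU : IsOpen (s ∩ (· + v) ⁻¹' s) := hso.inter (hso.preimage (by fun_prop))
  have hcont : ContinuousAt (fun z ↦ h (z + v) - h z) y :=
    ((hh.continuousOn.continuousAt (hso.mem_nhds hyv)).comp
      (f := (· + v)) (continuous_add_const v).continuousAt).sub
      (hh.continuousOn.continuousAt (hso.mem_nhds hy))
  refine ge_of_tendsto_of_frequently hcont
    ((mem_closure_iff_frequently.1 (hlines.open_subset_closure_inter hU ⟨hy, hyv⟩)).mono ?_)
  exact fun z ⟨⟨hz, hzv⟩, hzP⟩ ↦ le_sub_of_ae_segment_le_fderiv hh hsc hz hzv hzP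

end LowerBound

variable {E' : Type*} [NormedAddCommGroup E'] [NormedSpace ℝ E']

theorem exists_pos_forall_mul_norm_le [FiniteDimensional ℝ E] {C : Set (E →L[ℝ] E')}
    (hC : IsCompact C) (hinj : ∀ A ∈ C, Function.Injective A) :
    ∃ c > 0, ∀ A ∈ C, ∀ v, c * ‖v‖ ≤ ‖A v‖ := by
  have hcont : Continuous fun q : (E →L[ℝ] E') × E ↦ ‖q.1 q.2‖ := by fun_prop
  have hpos : ∀ q ∈ C ×ˢ sphere (0 : E) 1, 0 < ‖q.1 q.2‖ := fun ⟨A, v⟩ ⟨hA, hv⟩ ↦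
    norm_pos_iff.2 ((map_ne_zero_iff A (hinj A hA)).2 (ne_of_mem_sphere hv one_ne_zero))
  obtain ⟨c, hc, h⟩ :=
    (hC.prod (isCompact_sphere (0 : E) 1)).exists_forall_le' hcont.continuousOn hpos
  refine ⟨c, hc, fun A hA v ↦ ?_⟩
  rcases eq_or_ne v 0 with rfl | hv
  · simp
  have hn : 0 < ‖v‖ := norm_pos_iff.2 hv
  have := h (A, ‖v‖⁻¹ • v) ⟨hA, by simp [norm_smul, hn.ne']⟩
  simp only [map_smul, norm_smul, norm_inv, norm_norm] at this
  rwa [le_inv_mul_iff₀ hn, mul_comm] at this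

/-- The limits of the derivatives of `g` at points of differentiability converging to `a`; their
convex hull is Clarke's generalized differential of `g` at `a`. -/
def limitingDerivatives (g : E → E') (a : E) : Set (E →L[ℝ] E') :=
  {A | MapClusterPt A (𝓝 a ⊓ 𝓟 {y | DifferentiableAt ℝ g y}) (fderiv ℝ g)}

variable {g : E → E'} {a : E} {K : ℝ≥0} {U : Set E}

theorem exists_seq_of_mem_limitingDerivatives {A : E →L[ℝ] E'} (hA : A ∈ limitingDerivatives g a) :
    ∃ u : ℕ → E, Tendsto u atTop (𝓝 a) ∧ (∀ i, DifferentiableAt ℝ g (u i)) ∧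
      Tendsto (fun i ↦ fderiv ℝ g (u i)) atTop (𝓝 A) := by
  obtain ⟨u, hu, hua⟩ := MapClusterPt.exists_seq_tendsto hA
  rw [tendsto_inf, tendsto_principal] at hua
  obtain ⟨k, hk⟩ := eventually_atTop.1 hua.2
  exact ⟨fun i ↦ u (i + k), (tendsto_add_atTop_iff_nat k).2 hua.1, fun i ↦ hk _ (by simp),
    (tendsto_add_atTop_iff_nat k).2 hu⟩

theorem eventually_norm_fderiv_le (hU : U ∈ 𝓝 a) (hg : LipschitzOnWith K g U) :
    ∀ᶠ y in 𝓝 a, fderiv ℝ g y ∈ closedBall 0 K := by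
  filter_upwards [eventually_mem_nhds_iff.2 hU] with y hy
  exact mem_closedBall_zero_iff.2 (norm_fderiv_le_of_lipschitzOn ℝ hy hg)

theorem isCompact_limitingDerivatives [FiniteDimensional ℝ E] [FiniteDimensional ℝ E']
    (hU : U ∈ 𝓝 a) (hg : LipschitzOnWith K g U) : IsCompact (limitingDerivatives g a) := by
  refine (isCompact_closedBall (0 : E →L[ℝ] E') K).of_isClosed_subset isClosed_setOfPred_clusterPt
    fun A hA ↦ ?_
  refine isClosed_closedBall.mem_of_mapClusterPt hA ?_
  exact (eventually_norm_fderiv_le hU hg).filter_mono inf_le_left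

theorem eventually_fderiv_mem_of_limitingDerivatives_subset [FiniteDimensional ℝ E]
    [FiniteDimensional ℝ E'] (hU : U ∈ 𝓝 a) (hg : LipschitzOnWith K g U) {V : Set (E →L[ℝ] E')}
    (hV : IsOpen V) (hgV : limitingDerivatives g a ⊆ V) :
    ∀ᶠ y in 𝓝 a, DifferentiableAt ℝ g y → fderiv ℝ g y ∈ V := by
  refine eventually_inf_principal.1 ((isCompact_closedBall (0 : E →L[ℝ] E') K).adherence_nhdset
    (f := map (fderiv ℝ g) _) ?_ hV fun A _ hA ↦ hgV hA)
  exact le_principal_iff.2 ((eventually_norm_fderiv_le hU hg).filter_mono inf_le_left)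

theorem convexlyExpandingAt_of_injective [FiniteDimensional ℝ E] [FiniteDimensional ℝ E']
    (hU : U ∈ 𝓝 a) (hg : LipschitzOnWith K g U)
    (hinj : ∀ A ∈ convexHull ℝ (limitingDerivatives g a), Function.Injective A) :
    ConvexlyExpandingAt g a := by
  set C := convexHull ℝ (limitingDerivatives g a)
  obtain ⟨c, hc, hcC⟩ := exists_pos_forall_mul_norm_le
    (isCompact_convexHull (isCompact_limitingDerivatives hU hg)) hinj
  have hthick := eventually_fderiv_mem_of_limitingDerivatives_subset hU hg
    (isOpen_thickening (δ := c / 2) (E := C))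
    ((subset_convexHull ℝ _).trans (self_subset_thickening (half_pos hc) _))
  obtain ⟨r, hr, hrU⟩ := Metric.mem_nhds_iff.1 (inter_mem hU hthick)
  refine ⟨c / 2, half_pos hc, ball a r, ball_mem_nhds a hr, fun v ↦ ?_⟩
  obtain ⟨l, hl, hlC⟩ := exists_forall_le_apply_of_convex (c := c * ‖v‖)
    ((convex_convexHull ℝ (limitingDerivatives g a)).linear_image
      (ContinuousLinearMap.apply ℝ E' v).toLinearMap)
    (by rintro _ ⟨A, hA, rfl⟩; exact hcC A hA v)
  refine ⟨l, hl, fun y hy hyv ↦ ?_⟩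
  have hlg := l.lipschitz.comp_lipschitzOnWith (hg.mono fun z hz ↦ (hrU hz).1)
  borelize E
  rw [map_sub]
  refine le_sub_of_ae_le_fderiv (ν := Measure.addHaar) hlg isOpen_ball (convex_ball a r) ?_ hy hyv
  filter_upwards [hg.ae_differentiableWithinAt_of_mem] with z hz hzr
  have hgz : DifferentiableAt ℝ g z :=
    (hz (hrU hzr).1).differentiableAt (mem_of_superset (isOpen_ball.mem_nhds hzr)
      fun w hw ↦ (hrU hw).1)
  obtain ⟨A, hA, hAz⟩ := mem_thickening_iff.1 ((hrU hzr).2 hgz)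
  have hlA : c * ‖v‖ ≤ l (A v) := hlC (A v) ⟨A, hA, rfl⟩
  have hlz : |l (fderiv ℝ g z v) - l (A v)| ≤ c / 2 * ‖v‖ := by
    rw [dist_eq_norm] at hAz
    simpa using l.le_of_opNorm_le_of_le hl ((fderiv ℝ g z - A).le_of_opNorm_le hAz.le v)
  rw [(l.hasFDerivAt.comp z hgz.hasFDerivAt).fderiv, ContinuousLinearMap.comp_apply]
  linarith [(abs_le.1 hlz).1]

end ClarkeDifferential

section CoordChange

variable {E : Type*} [NormedAddCommGroup E] [NormedSpace ℝ E]
  {M : Type*} [TopologicalSpace M] [ChartedSpace E M]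

theorem tendsto_extChartAt_symm {x₀ p : M} (hp : p ∈ (extChartAt 𝓘(ℝ, E) x₀).source) :
    Tendsto (extChartAt 𝓘(ℝ, E) x₀).symm (𝓝 (extChartAt 𝓘(ℝ, E) x₀ p)) (𝓝 p) := by
  have := continuousAt_extChartAt_symm' (I := 𝓘(ℝ, E)) hp
  rwa [ContinuousAt, (extChartAt 𝓘(ℝ, E) x₀).left_inv hp] at this

variable [IsManifold 𝓘(ℝ, E) ∞ M]

theorem exists_hasStrictFDerivAt_coordChange {x₀ x₁ p : M}
    (h₀ : p ∈ (extChartAt 𝓘(ℝ, E) x₀).source) (h₁ : p ∈ (extChartAt 𝓘(ℝ, E) x₁).source) :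
    ∃ T : E ≃L[ℝ] E, HasStrictFDerivAt (extChartAt 𝓘(ℝ, E) x₁ ∘ (extChartAt 𝓘(ℝ, E) x₀).symm)
      (T : E →L[ℝ] E) (extChartAt 𝓘(ℝ, E) x₀ p) := by
  have hsmooth : ContDiffAt ℝ ∞ (extChartAt 𝓘(ℝ, E) x₁ ∘ (extChartAt 𝓘(ℝ, E) x₀).symm)
      (extChartAt 𝓘(ℝ, E) x₀ p) := by
    have := contDiffWithinAt_ext_coord_change (I := 𝓘(ℝ, E)) (n := ∞) x₁ x₀
      (y := extChartAt 𝓘(ℝ, E) x₀ p) (by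
        rw [ext_coord_change_source]
        rw [extChartAt_source] at h₀ h₁
        exact ⟨chartAt E x₀ p, by simp [h₀, h₁], rfl⟩)
    simpa [contDiffWithinAt_univ] using this
  refine ⟨ContinuousLinearEquiv.equivOfInverse (tangentCoordChange 𝓘(ℝ, E) x₀ x₁ p)
    (tangentCoordChange 𝓘(ℝ, E) x₁ x₀ p) (fun v ↦ ?_) (fun v ↦ ?_), ?_⟩
  · rw [tangentCoordChange_comp ⟨⟨h₀, h₁⟩, h₀⟩, tangentCoordChange_self h₀]
  · rw [tangentCoordChange_comp ⟨⟨h₁, h₀⟩, h₁⟩, tangentCoordChange_self h₁]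
  · convert hsmooth.hasStrictFDerivAt (by simp) using 1
    ext v
    simp [fderivWithin_univ]

theorem hasDerivWithinAt_extChartAt_comp {p : M} {γ : ℝ → M} {s : Set ℝ} {t : ℝ}
    (hγ : MDifferentiableWithinAt 𝓘(ℝ, ℝ) 𝓘(ℝ, E) γ s t)
    (ht : γ t ∈ (extChartAt 𝓘(ℝ, E) p).source) :
    HasDerivWithinAt (extChartAt 𝓘(ℝ, E) p ∘ γ)
      ((trivializationAt E (TangentSpace 𝓘(ℝ, E) : M → Type _) p).continuousLinearMapAt ℝ (γ t)
        (mfderivWithin 𝓘(ℝ, ℝ) 𝓘(ℝ, E) γ s t 1)) s t := by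
  have ht' : γ t ∈ (chartAt E p).source := by rwa [← extChartAt_source 𝓘(ℝ, E)]
  have hchart := (mdifferentiableAt_extChartAt (I := 𝓘(ℝ, E)) ht').hasMFDerivAt
  rw [TangentBundle.continuousLinearMapAt_trivializationAt ht']
  have hcomp : HasFDerivWithinAt (extChartAt 𝓘(ℝ, E) p ∘ γ)
      ((show E →L[ℝ] E from mfderiv 𝓘(ℝ, E) 𝓘(ℝ, E) (extChartAt 𝓘(ℝ, E) p) (γ t)) ∘L
        (show ℝ →L[ℝ] E from mfderivWithin 𝓘(ℝ, ℝ) 𝓘(ℝ, E) γ s t)) s t :=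
    (hchart.comp_hasMFDerivWithinAt t hγ.hasMFDerivWithinAt).hasFDerivWithinAt
  exact hcomp.hasDerivWithinAt

end CoordChange

section RiemannianDistance

variable {E : Type*} [NormedAddCommGroup E] [NormedSpace ℝ E]
  {M : Type*} [EMetricSpace M] [ChartedSpace E M]
  [RiemannianBundle (fun x : M ↦ TangentSpace 𝓘(ℝ, E) x)]

theorem edist_le_pathELength [IsRiemannianManifold 𝓘(ℝ, E) M] {γ : ℝ → M} {a b : ℝ}
    (hγ : ContMDiffOn 𝓘(ℝ, ℝ) 𝓘(ℝ, E) 1 γ (Icc a b)) (hab : a ≤ b) :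
    edist (γ a) (γ b) ≤ pathELength 𝓘(ℝ, E) γ a b := by
  rw [IsRiemannianManifold.out (I := 𝓘(ℝ, E))]
  exact riemannianEDist_le_pathELength hγ rfl rfl hab

theorem le_mul_edist_of_forall_pathELength [IsRiemannianManifold 𝓘(ℝ, E) M] {x y : M}
    {a C : ℝ≥0∞} {K : ℝ≥0} (ha : edist x y < a)
    (h : ∀ γ : ℝ → M, ContMDiff 𝓘(ℝ, ℝ) 𝓘(ℝ, E) 1 γ → γ 0 = x → γ 1 = y →
      pathELength 𝓘(ℝ, E) γ 0 1 < a → C ≤ K * pathELength 𝓘(ℝ, E) γ 0 1) :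
    C ≤ K * edist x y := by
  have hlim : Tendsto (fun s : ℝ≥0∞ ↦ K * s) (𝓝[>] edist x y) (𝓝 (K * edist x y)) :=
    ((ENNReal.continuous_const_mul ENNReal.coe_ne_top).tendsto _).mono_left nhdsWithin_le_nhds
  have : (𝓝[>] edist x y).NeBot := nhdsGT_neBot_of_exists_gt ⟨a, ha⟩
  refine ge_of_tendsto hlim ?_
  filter_upwards [self_mem_nhdsWithin, nhdsWithin_le_nhds (gt_mem_nhds ha)] with s hs hsa
  rw [mem_Ioi, IsRiemannianManifold.out (I := 𝓘(ℝ, E))] at hs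
  obtain ⟨γ, hγ₀, hγ₁, hγ, hγs, -⟩ :=
    exists_lt_locally_constant_of_riemannianEDist_lt hs zero_lt_one
  exact (h γ hγ hγ₀ hγ₁ (hγs.trans hsa)).trans (by gcongr)

theorem edist_comp_le_mul_pathELength [IsRiemannianManifold 𝓘(ℝ, E) M]
    {Y : Type*} [PseudoEMetricSpace Y] {G : M → Y} {K : ℝ≥0}
    (hG : ∀ p, ∃ U ∈ 𝓝 p, LipschitzOnWith K G U) {γ : ℝ → M}
    (hγ : ContMDiffOn 𝓘(ℝ, ℝ) 𝓘(ℝ, E) 1 γ (Icc 0 1)) :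
    edist (G (γ 0)) (G (γ 1)) ≤ K * pathELength 𝓘(ℝ, E) γ 0 1 := by
  choose U hU hGU using hG
  obtain ⟨t, ht0, htm, ⟨n, hn⟩, ht⟩ := exists_monotone_Icc_subset_open_cover_Icc
    (zero_le_one (α := ℝ)) (c := fun p ↦ (fun t : Icc (0 : ℝ) 1 ↦ γ t) ⁻¹' interior (U p))
    (fun p ↦ isOpen_interior.preimage (continuousOn_iff_continuous_domRestrict.1 hγ.continuousOn))
    (fun t _ ↦ mem_iUnion.2 ⟨γ t, mem_interior_iff_mem_nhds.2 (hU _)⟩)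
  suffices h : ∀ k, edist (G (γ 0)) (G (γ (t k))) ≤ K * pathELength 𝓘(ℝ, E) γ 0 (t k) by
    simpa only [hn n le_rfl] using h n
  intro k
  induction k with
  | zero => simp [ht0]
  | succ k ih =>
    obtain ⟨p, hp⟩ := ht k
    have hle : t k ≤ t (k + 1) := htm (Nat.le_succ k)
    have hstep : edist (G (γ (t k))) (G (γ (t (k + 1)))) ≤
        K * pathELength 𝓘(ℝ, E) γ (t k) (t (k + 1)) := by
      refine (hGU p (interior_subset (hp ⟨le_rfl, hle⟩))
        (interior_subset (hp ⟨hle, le_rfl⟩))).trans ?_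
      gcongr
      exact edist_le_pathELength (hγ.mono (Icc_subset_Icc (t k).2.1 (t (k + 1)).2.2)) hle
    calc edist (G (γ 0)) (G (γ (t (k + 1))))
        ≤ edist (G (γ 0)) (G (γ (t k))) + edist (G (γ (t k))) (G (γ (t (k + 1)))) :=
          edist_triangle _ _ _
      _ ≤ K * pathELength 𝓘(ℝ, E) γ 0 (t k) + K * pathELength 𝓘(ℝ, E) γ (t k) (t (k + 1)) :=
          add_le_add ih hstep
      _ = K * pathELength 𝓘(ℝ, E) γ 0 (t (k + 1)) := by
          rw [← mul_add, pathELength_add (t k).2.1 hle]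

variable (E) in
theorem lipschitzWith_of_locally [IsRiemannianManifold 𝓘(ℝ, E) M]
    {Y : Type*} [PseudoEMetricSpace Y] {G : M → Y} {K : ℝ≥0}
    (hK : 0 < K) (hG : ∀ p, ∃ U ∈ 𝓝 p, LipschitzOnWith K G U) : LipschitzWith K G := by
  intro x y
  rcases eq_top_or_lt_top (edist x y) with htop | hlt
  · rw [htop, ENNReal.mul_top (by exact_mod_cast hK.ne')]
    exact le_top
  · refine le_mul_edist_of_forall_pathELength (E := E) hlt ?_
    rintro γ hγ rfl rfl -
    exact edist_comp_le_mul_pathELength (E := E) hG hγ.contMDiffOn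

end RiemannianDistance

section TangentNorm

variable {E : Type*} [NormedAddCommGroup E] [NormedSpace ℝ E]
  {M : Type*} [EMetricSpace M] [ChartedSpace E M]
  [RiemannianBundle (fun x : M ↦ TangentSpace 𝓘(ℝ, E) x)] [IsManifold 𝓘(ℝ, E) ∞ M]

local notation "τ" => trivializationAt E (TangentSpace 𝓘(ℝ, E) : M → Type _)

theorem eventually_enorm_symmL_le
    [IsContinuousRiemannianBundle E (fun x : M ↦ TangentSpace 𝓘(ℝ, E) x)]
    (p : M) {r : ℝ≥0} (hr : 1 < r) :
    ∀ᶠ y in 𝓝 p, ∀ w : E, ‖(τ p).symmL ℝ y w‖ₑ ≤ r * ‖(τ p).symmL ℝ p w‖ₑ := by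
  filter_upwards [eventually_norm_symmL_trivializationAt_comp_self_lt E
    (TangentSpace 𝓘(ℝ, E) : M → Type _) p (r := r) (by exact_mod_cast hr)] with y hy w
  have h := ContinuousLinearMap.le_of_opNorm_le _ hy.le ((τ p).symmL ℝ p w)
  rw [ContinuousLinearMap.comp_apply, Trivialization.continuousLinearMapAt_symmL _
    (FiberBundle.mem_baseSet_trivializationAt' p)] at h
  have h' := ENNReal.ofReal_le_ofReal h
  rwa [ENNReal.ofReal_mul r.coe_nonneg, ENNReal.ofReal_coe_nnreal, ofReal_norm, ofReal_norm] at h'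

theorem eventually_enorm_continuousLinearMapAt_le
    [IsContinuousRiemannianBundle E (fun x : M ↦ TangentSpace 𝓘(ℝ, E) x)]
    (p : M) {r : ℝ≥0} (hr : 1 < r) :
    ∀ᶠ y in 𝓝 p, ∀ u : TangentSpace 𝓘(ℝ, E) y,
      ‖(τ p).symmL ℝ p ((τ p).continuousLinearMapAt ℝ y u)‖ₑ ≤ r * ‖u‖ₑ := by
  filter_upwards [eventually_norm_symmL_trivializationAt_self_comp_lt E
    (TangentSpace 𝓘(ℝ, E) : M → Type _) p (r := r) (by exact_mod_cast hr)] with y hy u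
  have h := ContinuousLinearMap.le_of_opNorm_le _ hy.le u
  rw [ContinuousLinearMap.comp_apply] at h
  have h' := ENNReal.ofReal_le_ofReal h
  rwa [ENNReal.ofReal_mul r.coe_nonneg, ENNReal.ofReal_coe_nnreal, ofReal_norm, ofReal_norm] at h'

theorem enorm_map_sub_le_mul_pathELength {p : M} {F : Type*} [NormedAddCommGroup F]
    [NormedSpace ℝ F] {T : E →L[ℝ] F} {γ : ℝ → M} {r : ℝ≥0}
    (hγ : ContMDiffOn 𝓘(ℝ, ℝ) 𝓘(ℝ, E) 1 γ (Icc 0 1))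
    (hsource : ∀ t ∈ Icc (0 : ℝ) 1, γ t ∈ (extChartAt 𝓘(ℝ, E) p).source)
    (hT : ∀ t ∈ Icc (0 : ℝ) 1, ∀ u : TangentSpace 𝓘(ℝ, E) (γ t),
      ‖T ((τ p).continuousLinearMapAt ℝ (γ t) u)‖ₑ ≤ r * ‖u‖ₑ) :
    ‖T (extChartAt 𝓘(ℝ, E) p (γ 1) - extChartAt 𝓘(ℝ, E) p (γ 0))‖ₑ ≤
      r * pathELength 𝓘(ℝ, E) γ 0 1 := by
  have hsmooth : ContDiffOn ℝ 1 (T ∘ extChartAt 𝓘(ℝ, E) p ∘ γ) (Icc 0 1) := by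
    refine T.contDiff.comp_contDiffOn ?_
    rw [← contMDiffOn_iff_contDiffOn]
    exact contMDiffOn_extChartAt.comp hγ fun t ht ↦ by simpa using hsource t ht
  have hderiv (t) (ht : t ∈ Icc (0 : ℝ) 1) : HasDerivWithinAt (T ∘ extChartAt 𝓘(ℝ, E) p ∘ γ)
      (T ((τ p).continuousLinearMapAt ℝ (γ t)
        (mfderivWithin 𝓘(ℝ, ℝ) 𝓘(ℝ, E) γ (Icc 0 1) t 1))) (Icc 0 1) t :=
    T.hasFDerivAt.comp_hasDerivWithinAt t (hasDerivWithinAt_extChartAt_comp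
      (hγ.mdifferentiableOn one_ne_zero t ht) (hsource t ht))
  rw [map_sub, pathELength_eq_lintegral_mfderivWithin_Icc,
    ← lintegral_const_mul' _ _ ENNReal.coe_ne_top]
  refine (enorm_sub_le_lintegral_derivWithin_Icc_of_contDiffOn_Icc hsmooth zero_le_one).trans
    (setLIntegral_mono' measurableSet_Icc fun t ht ↦ ?_)
  rw [(hderiv t ht).derivWithin (uniqueDiffOn_Icc zero_lt_one t ht)]
  exact hT t ht _

variable [IsRiemannianManifold 𝓘(ℝ, E) M]

theorem edist_extChartAt_symm_le {p : M} {a b : E} {C : ℝ≥0∞}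
    (htarget : segment ℝ a b ⊆ (extChartAt 𝓘(ℝ, E) p).target)
    (hC : ∀ w ∈ segment ℝ a b, ‖(τ p).symmL ℝ ((extChartAt 𝓘(ℝ, E) p).symm w) (b - a)‖ₑ ≤ C) :
    edist ((extChartAt 𝓘(ℝ, E) p).symm a) ((extChartAt 𝓘(ℝ, E) p).symm b) ≤ C := by
  set φ := extChartAt 𝓘(ℝ, E) p
  have hseg (t) (ht : t ∈ Icc (0 : ℝ) 1) : AffineMap.lineMap a b t ∈ segment ℝ a b := by
    rw [segment_eq_image_lineMap]
    exact mem_image_of_mem _ ht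
  let γ : ℝ → M := φ.symm ∘ AffineMap.lineMap a b
  have hsmooth : ContDiff ℝ 1 (AffineMap.lineMap a b : ℝ → E) :=
    (ContinuousAffineMap.lineMap (R := ℝ) a b).contDiff
  have hγ : ContMDiffOn 𝓘(ℝ, ℝ) 𝓘(ℝ, E) 1 γ (Icc 0 1) :=
    (contMDiffOn_extChartAt_symm p).comp hsmooth.contMDiff.contMDiffOn
      fun t ht ↦ htarget (hseg t ht)
  have hspeed (t) (ht : t ∈ Icc (0 : ℝ) 1) :
      ‖mfderivWithin 𝓘(ℝ, ℝ) 𝓘(ℝ, E) γ (Icc 0 1) t 1‖ₑ ≤ C := by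
    have hγt : γ t ∈ φ.source := φ.map_target (htarget (hseg t ht))
    have hline : HasDerivWithinAt (φ ∘ γ) (b - a) (Icc 0 1) t :=
      AffineMap.hasDerivWithinAt_lineMap.congr (fun s hs ↦ φ.right_inv (htarget (hseg s hs)))
        (φ.right_inv (htarget (hseg t ht)))
    have hcoord := (uniqueDiffOn_Icc (zero_lt_one (α := ℝ)) t ht).eq_deriv _
      (hasDerivWithinAt_extChartAt_comp (hγ.mdifferentiableOn one_ne_zero t ht) hγt) hline
    have hbase : γ t ∈ (τ p).baseSet := by
      rwa [TangentBundle.trivializationAt_baseSet, ← extChartAt_source 𝓘(ℝ, E)]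
    rw [← Trivialization.symmL_continuousLinearMapAt (τ p) (R := ℝ) hbase
      (mfderivWithin 𝓘(ℝ, ℝ) 𝓘(ℝ, E) γ (Icc 0 1) t 1), hcoord]
    exact hC _ (hseg t ht)
  calc edist (φ.symm a) (φ.symm b) = edist (γ 0) (γ 1) := by simp [γ]
    _ ≤ pathELength 𝓘(ℝ, E) γ 0 1 := edist_le_pathELength hγ zero_le_one
    _ ≤ ∫⁻ _ in Icc (0 : ℝ) 1, C := by
        rw [pathELength_eq_lintegral_mfderivWithin_Icc]
        exact setLIntegral_mono' measurableSet_Icc hspeed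
    _ = C := by simp

variable [IsContinuousRiemannianBundle E (fun x : M ↦ TangentSpace 𝓘(ℝ, E) x)]

theorem eventually_edist_le_enorm_symmL (p : M) {r : ℝ≥0} (hr : 1 < r) :
    ∀ᶠ q : M × M in 𝓝 (p, p), edist q.1 q.2 ≤
      r * ‖(τ p).symmL ℝ p (extChartAt 𝓘(ℝ, E) p q.2 - extChartAt 𝓘(ℝ, E) p q.1)‖ₑ := by
  set φ := extChartAt 𝓘(ℝ, E) p
  have hgood : ∀ᶠ w in 𝓝 (φ p), w ∈ φ.target ∧
      ∀ u : E, ‖(τ p).symmL ℝ (φ.symm w) u‖ₑ ≤ r * ‖(τ p).symmL ℝ p u‖ₑ :=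
    (eventually_mem_set.2 (extChartAt_target_mem_nhds p)).and
      ((tendsto_extChartAt_symm (mem_extChartAt_source p)).eventually
        (eventually_enorm_symmL_le p hr))
  obtain ⟨ρ, hρ, hball⟩ := Metric.eventually_nhds_iff_ball.1 hgood
  have hchart : ∀ᶠ y in 𝓝 p, y ∈ φ.source ∧ φ y ∈ ball (φ p) ρ :=
    (eventually_mem_set.2 (extChartAt_source_mem_nhds p)).and
      ((continuousAt_extChartAt p).eventually (ball_mem_nhds _ hρ))
  rw [nhds_prod_eq]
  filter_upwards [hchart.prod_mk hchart] with q ⟨⟨hy, hyρ⟩, ⟨hz, hzρ⟩⟩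
  have hseg := (convex_ball (φ p) ρ).segment_subset hyρ hzρ
  have := edist_extChartAt_symm_le (fun w hw ↦ (hball w (hseg hw)).1)
    (fun w hw ↦ (hball w (hseg hw)).2 _)
  rwa [φ.left_inv hy, φ.left_inv hz] at this

theorem eventually_enorm_symmL_le_edist (p : M) {r : ℝ≥0} (hr : 1 < r) :
    ∀ᶠ q : M × M in 𝓝 (p, p),
      ‖(τ p).symmL ℝ p (extChartAt 𝓘(ℝ, E) p q.2 - extChartAt 𝓘(ℝ, E) p q.1)‖ₑ ≤
        r * edist q.1 q.2 := by
  obtain ⟨δ, hδ, hball⟩ := EMetric.mem_nhds_iff.1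
    ((eventually_mem_set.2 (extChartAt_source_mem_nhds (I := 𝓘(ℝ, E)) p)).and
      (eventually_enorm_continuousLinearMapAt_le (E := E) p hr))
  have hnear : ∀ᶠ y in 𝓝 p, edist y p < δ / 3 :=
    Metric.eball_mem_nhds p (ENNReal.div_pos hδ.ne' (by simp))
  rw [nhds_prod_eq]
  filter_upwards [hnear.prod_mk hnear] with q ⟨hy, hz⟩
  have hyz : edist q.1 q.2 < δ / 3 + δ / 3 :=
    (edist_triangle_right _ _ p).trans_lt (ENNReal.add_lt_add hy hz)
  refine le_mul_edist_of_forall_pathELength (E := E) hyz fun γ hγ hγ₀ hγ₁ hlength ↦ ?_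
  have hstay (t) (ht : t ∈ Icc (0 : ℝ) 1) : γ t ∈ Metric.eball p δ :=
    calc edist (γ t) p ≤ edist q.1 (γ t) + edist q.1 p := edist_triangle_left _ _ _
      _ < δ / 3 + δ / 3 + δ / 3 := by
          refine ENNReal.add_lt_add (lt_of_le_of_lt ?_ hlength) hy
          rw [← hγ₀]
          exact (edist_le_pathELength hγ.contMDiffOn ht.1).trans (pathELength_mono le_rfl ht.2)
      _ = δ := ENNReal.add_thirds δ
  rw [← hγ₀, ← hγ₁]
  exact enorm_map_sub_le_mul_pathELength hγ.contMDiffOn (fun t ht ↦ (hball (hstay t ht)).1)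
    fun t ht ↦ (hball (hstay t ht)).2

end TangentNorm

section DistNorm

theorem exists_one_lt_sq_mul_lt {K L : ℝ≥0} (h : K < L) : ∃ r : ℝ≥0, 1 < r ∧ r * r * K < L := by
  have hlim : Tendsto (fun r : ℝ≥0 ↦ r * r * K) (𝓝[>] 1) (𝓝 (1 * 1 * K)) :=
    (Continuous.tendsto (by fun_prop) _).mono_left nhdsWithin_le_nhds
  rw [one_mul, one_mul] at hlim
  obtain ⟨r, hrL, hr⟩ := ((hlim.eventually (gt_mem_nhds h)).and self_mem_nhdsWithin).exists
  exact ⟨r, hr, hrL⟩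

theorem ofReal_le_coe_mul_ofReal {a b : ℝ} (hb : 0 ≤ b) {K : ℝ≥0} :
    ENNReal.ofReal a ≤ K * ENNReal.ofReal b ↔ a ≤ K * b := by
  rw [← ENNReal.ofReal_coe_nnreal, ← ENNReal.ofReal_mul K.coe_nonneg,
    ENNReal.ofReal_le_ofReal_iff (by positivity)]

theorem eventually_seminorm_sub_le_and_le {E F : Type*} [NormedAddCommGroup E] [NormedSpace ℝ E]
    [NormedAddCommGroup F] [NormedSpace ℝ F] {σ : E → F} {T : E →L[ℝ] F} {a : E}
    (hσ : HasStrictFDerivAt σ T a) {ν : Seminorm ℝ F} {C C' : ℝ} (hC : 0 < C) (hC' : 0 < C')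
    (hν : ∀ v, ν v ≤ C * ‖v‖) (hT : ∀ v, ‖v‖ ≤ C' * ν (T v)) {r : ℝ} (hr : 1 < r) :
    ∀ᶠ q : E × E in 𝓝 (a, a), ν (σ q.2 - σ q.1) ≤ r * ν (T (q.2 - q.1)) ∧
      ν (T (q.2 - q.1)) ≤ r * ν (σ q.2 - σ q.1) := by
  have hr₀ : 0 < r := zero_lt_one.trans hr
  have hκ : 0 < 1 - r⁻¹ := sub_pos.2 (inv_lt_one_of_one_lt₀ hr)
  have hswap : Tendsto Prod.swap (𝓝 (a, a)) (𝓝 (a, a)) := continuous_swap.tendsto (a, a)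
  filter_upwards [hswap.eventually
    ((hasStrictFDerivAt_iff_isLittleO.1 hσ).def (c := (1 - r⁻¹) / (C * C')) (by positivity))]
    with q hq
  simp only [Prod.fst_swap, Prod.snd_swap] at hq
  have hsmall : ν (σ q.2 - σ q.1 - T (q.2 - q.1)) ≤ (1 - r⁻¹) * ν (T (q.2 - q.1)) :=
    calc ν (σ q.2 - σ q.1 - T (q.2 - q.1))
        ≤ C * ((1 - r⁻¹) / (C * C') * (C' * ν (T (q.2 - q.1)))) :=
          (hν _).trans (by gcongr; exact hq.trans (by gcongr; exact hT _))
      _ = (1 - r⁻¹) * ν (T (q.2 - q.1)) := by field_simp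
  have hpos := apply_nonneg ν (T (q.2 - q.1))
  constructor
  · have hsum : 1 + (1 - r⁻¹) ≤ r := by
      have : 2 ≤ r + r⁻¹ := by
        rw [← sub_nonneg, show r + r⁻¹ - 2 = (r - 1) ^ 2 / r by field_simp; ring]
        positivity
      linarith
    have := map_add_le_add ν (T (q.2 - q.1)) (σ q.2 - σ q.1 - T (q.2 - q.1))
    rw [add_sub_cancel] at this
    nlinarith
  · have := map_sub_le_add ν (σ q.2 - σ q.1) (σ q.2 - σ q.1 - T (q.2 - q.1))
    rw [sub_sub_cancel] at this
    rw [← inv_mul_le_iff₀ hr₀]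
    linarith

theorem exists_norm_equiv_comp {E F : Type*} [NormedAddCommGroup E] [NormedSpace ℝ E]
    [NormedAddCommGroup F] [NormedSpace ℝ F] (T : E ≃L[ℝ] F) {ν : Seminorm ℝ F} {C : ℝ}
    (hC : 0 < C) (hνC : ∀ v, ν v ≤ C * ‖v‖) (hCν : ∀ v, ‖v‖ ≤ C * ν v) :
    ∃ C' > 0, (∀ v, ν (T v) ≤ C' * ‖v‖) ∧ ∀ v, ‖v‖ ≤ C' * ν (T v) := by
  refine ⟨C * (‖(T : E →L[ℝ] F)‖ + ‖(T.symm : F →L[ℝ] E)‖ + 1), by positivity, fun v ↦ ?_,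
    fun v ↦ ?_⟩
  · have hT := (T : E →L[ℝ] F).le_of_opNorm_le (le_add_of_nonneg_right
      (by positivity : 0 ≤ ‖(T.symm : F →L[ℝ] E)‖ + 1)) v
    calc ν (T v) ≤ C * ‖T v‖ := hνC _
      _ ≤ C * ((‖(T : E →L[ℝ] F)‖ + (‖(T.symm : F →L[ℝ] E)‖ + 1)) * ‖v‖) := by gcongr; exact hT
      _ = _ := by ring
  · have hT := (T.symm : F →L[ℝ] E).le_of_opNorm_le (le_add_of_nonneg_right
      (by positivity : 0 ≤ ‖(T : E →L[ℝ] F)‖ + 1)) (T v)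
    calc ‖v‖ ≤ (‖(T.symm : F →L[ℝ] E)‖ + (‖(T : E →L[ℝ] F)‖ + 1)) * ‖T v‖ := by simpa using hT
      _ ≤ (‖(T.symm : F →L[ℝ] E)‖ + (‖(T : E →L[ℝ] F)‖ + 1)) * (C * ν (T v)) := by
          gcongr
          exact hCν _
      _ = _ := by ring

variable {E : Type*} [NormedAddCommGroup E] [NormedSpace ℝ E]
  {M : Type*} [EMetricSpace M] [ChartedSpace E M]

/-- The seminorm `ν` on the model space, which is equivalent to the norm, describes the distance of
`M` near `p` in the chart at `x₀`, up to a factor tending to `1` at `p`. -/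
structure IsDistNormAt (x₀ p : M) (ν : Seminorm ℝ E) : Prop where
  exists_norm_equiv : ∃ C > 0, (∀ v, ν v ≤ C * ‖v‖) ∧ ∀ v, ‖v‖ ≤ C * ν v
  eventually_edist_le : ∀ r : ℝ≥0, 1 < r → ∀ᶠ q : M × M in 𝓝 (p, p), edist q.1 q.2 ≤
    r * ENNReal.ofReal (ν (extChartAt 𝓘(ℝ, E) x₀ q.2 - extChartAt 𝓘(ℝ, E) x₀ q.1))
  eventually_le_edist : ∀ r : ℝ≥0, 1 < r → ∀ᶠ q : M × M in 𝓝 (p, p),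
    ENNReal.ofReal (ν (extChartAt 𝓘(ℝ, E) x₀ q.2 - extChartAt 𝓘(ℝ, E) x₀ q.1)) ≤
      r * edist q.1 q.2

theorem eventually_seminorm_extChartAt_le_and_le {x₀ x₁ p : M}
    (h₀ : p ∈ (extChartAt 𝓘(ℝ, E) x₀).source) {T : E →L[ℝ] E}
    (hT : HasStrictFDerivAt (extChartAt 𝓘(ℝ, E) x₁ ∘ (extChartAt 𝓘(ℝ, E) x₀).symm) T
      (extChartAt 𝓘(ℝ, E) x₀ p)) {ν : Seminorm ℝ E} {C C' : ℝ} (hC : 0 < C) (hC' : 0 < C')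
    (hν : ∀ v, ν v ≤ C * ‖v‖) (hνT : ∀ v, ‖v‖ ≤ C' * ν (T v)) {r : ℝ} (hr : 1 < r) :
    ∀ᶠ q : M × M in 𝓝 (p, p),
      ν (extChartAt 𝓘(ℝ, E) x₁ q.2 - extChartAt 𝓘(ℝ, E) x₁ q.1) ≤
        r * ν (T (extChartAt 𝓘(ℝ, E) x₀ q.2 - extChartAt 𝓘(ℝ, E) x₀ q.1)) ∧
      ν (T (extChartAt 𝓘(ℝ, E) x₀ q.2 - extChartAt 𝓘(ℝ, E) x₀ q.1)) ≤
        r * ν (extChartAt 𝓘(ℝ, E) x₁ q.2 - extChartAt 𝓘(ℝ, E) x₁ q.1) := by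
  set φ₀ := extChartAt 𝓘(ℝ, E) x₀
  have hφ : ContinuousAt (fun q : M × M ↦ (φ₀ q.1, φ₀ q.2)) (p, p) :=
    (continuousAt_extChartAt' h₀).prodMap (continuousAt_extChartAt' h₀)
  have hsource : ∀ᶠ y in 𝓝 p, y ∈ φ₀.source := (isOpen_extChartAt_source x₀).mem_nhds h₀
  have hsource₂ := hsource.prod_mk hsource
  rw [← nhds_prod_eq] at hsource₂
  filter_upwards [hsource₂,
    hφ.eventually (eventually_seminorm_sub_le_and_le hT hC hC' hν hνT hr)] with q ⟨h₁, h₂⟩ h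
  simpa [φ₀.left_inv h₁, φ₀.left_inv h₂] using h

theorem IsDistNormAt.exists_change_chart [IsManifold 𝓘(ℝ, E) ∞ M] {x₀ x₁ p : M}
    {ν : Seminorm ℝ E} (hν : IsDistNormAt x₁ p ν) (h₀ : p ∈ (extChartAt 𝓘(ℝ, E) x₀).source)
    (h₁ : p ∈ (extChartAt 𝓘(ℝ, E) x₁).source) :
    ∃ ν' : Seminorm ℝ E, IsDistNormAt x₀ p ν' := by
  obtain ⟨T, hT⟩ := exists_hasStrictFDerivAt_coordChange h₀ h₁
  obtain ⟨C, hC, hνC, hCν⟩ := hν.exists_norm_equiv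
  obtain ⟨C', hC', hνC', hCν'⟩ := exists_norm_equiv_comp T hC hνC hCν
  refine ⟨ν.comp (T : E →L[ℝ] E).toLinearMap, ⟨C', hC', hνC', hCν'⟩, fun r hr ↦ ?_,
    fun r hr ↦ ?_⟩
  all_goals
    obtain ⟨s, hs, hsr⟩ := exists_one_lt_sq_mul_lt hr
    rw [mul_one] at hsr
    have hcoord := eventually_seminorm_extChartAt_le_and_le h₀ hT hC hC' hνC hCν' (r := s)
      (by exact_mod_cast hs)
  · filter_upwards [hcoord, hν.eventually_edist_le s hs] with q ⟨h, _⟩ hedist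
    rw [← ofReal_le_coe_mul_ofReal (apply_nonneg ν _)] at h
    calc edist q.1 q.2 ≤ s * (s * ENNReal.ofReal (ν (T (extChartAt 𝓘(ℝ, E) x₀ q.2 -
            extChartAt 𝓘(ℝ, E) x₀ q.1)))) := hedist.trans (by gcongr; exact h)
      _ ≤ r * ENNReal.ofReal (ν (T (extChartAt 𝓘(ℝ, E) x₀ q.2 -
            extChartAt 𝓘(ℝ, E) x₀ q.1))) := by
        rw [← mul_assoc]
        gcongr
        exact_mod_cast hsr.le
  · filter_upwards [hcoord, hν.eventually_le_edist s hs] with q ⟨_, h⟩ hedist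
    rw [← ofReal_le_coe_mul_ofReal (apply_nonneg ν _)] at h
    calc _ ≤ s * (s * edist q.1 q.2) := h.trans (by gcongr)
      _ ≤ r * edist q.1 q.2 := by
        rw [← mul_assoc]
        gcongr
        exact_mod_cast hsr.le

variable [RiemannianBundle (fun x : M ↦ TangentSpace 𝓘(ℝ, E) x)] [IsManifold 𝓘(ℝ, E) ∞ M]
  [IsRiemannianManifold 𝓘(ℝ, E) M]
  [IsContinuousRiemannianBundle E (fun x : M ↦ TangentSpace 𝓘(ℝ, E) x)]

theorem exists_isDistNormAt_self (p : M) : ∃ ν : Seminorm ℝ E, IsDistNormAt p p ν := by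
  let τ := trivializationAt E (TangentSpace 𝓘(ℝ, E) : M → Type _) p
  have hp : p ∈ τ.baseSet := FiberBundle.mem_baseSet_trivializationAt' p
  let A : E ≃L[ℝ] TangentSpace 𝓘(ℝ, E) p := .equivOfInverse (τ.symmL ℝ p)
    (τ.continuousLinearMapAt ℝ p) (τ.continuousLinearMapAt_symmL hp)
    (τ.symmL_continuousLinearMapAt hp)
  obtain ⟨C, hC, hνC, hCν⟩ := exists_norm_equiv_comp A
    (ν := normSeminorm ℝ (TangentSpace 𝓘(ℝ, E) p)) one_pos (by simp) (by simp)
  refine ⟨(normSeminorm ℝ (TangentSpace 𝓘(ℝ, E) p)).comp A.toContinuousLinearMap.toLinearMap,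
    ⟨C, hC, hνC, hCν⟩, fun r hr ↦ ?_, fun r hr ↦ ?_⟩
  · filter_upwards [eventually_edist_le_enorm_symmL (E := E) p hr] with q hq
    rw [← ofReal_norm] at hq
    exact hq
  · filter_upwards [eventually_enorm_symmL_le_edist (E := E) p hr] with q hq
    rw [← ofReal_norm] at hq
    exact hq

theorem exists_isDistNormAt {x₀ p : M} (hp : p ∈ (extChartAt 𝓘(ℝ, E) x₀).source) :
    ∃ ν : Seminorm ℝ E, IsDistNormAt x₀ p ν := by
  obtain ⟨ν, hν⟩ := exists_isDistNormAt_self (E := E) p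
  exact hν.exists_change_chart hp (mem_extChartAt_source p)

end DistNorm

section ChartRep

variable {E : Type*} [NormedAddCommGroup E] [NormedSpace ℝ E]
  {E' : Type*} [NormedAddCommGroup E'] [NormedSpace ℝ E']
  {M : Type*} [TopologicalSpace M] [ChartedSpace E M]
  {N : Type*} [TopologicalSpace N] [ChartedSpace E' N]

variable (E E') in
/-- The map `G` read in the charts at `x₀` and `y₀`. -/
noncomputable def chartRep (x₀ : M) (y₀ : N) (G : M → N) : E → E' :=
  extChartAt 𝓘(ℝ, E') y₀ ∘ G ∘ (extChartAt 𝓘(ℝ, E) x₀).symm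

theorem chartRep_extChartAt {x₀ p : M} (hp : p ∈ (extChartAt 𝓘(ℝ, E) x₀).source) (y₀ : N)
    (G : M → N) :
    chartRep E E' x₀ y₀ G (extChartAt 𝓘(ℝ, E) x₀ p) = extChartAt 𝓘(ℝ, E') y₀ (G p) := by
  simp only [chartRep, Function.comp_apply, (extChartAt 𝓘(ℝ, E) x₀).left_inv hp]

theorem continuousAt_chartRep {x₀ p : M} {y₀ : N} {G : M → N}
    (hp : p ∈ (extChartAt 𝓘(ℝ, E) x₀).source) (hGp : G p ∈ (extChartAt 𝓘(ℝ, E') y₀).source)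
    (hG : ContinuousAt G p) :
    ContinuousAt (chartRep E E' x₀ y₀ G) (extChartAt 𝓘(ℝ, E) x₀ p) := by
  rw [ContinuousAt, chartRep_extChartAt hp]
  exact ((continuousAt_extChartAt' hGp).tendsto.comp hG.tendsto).comp (tendsto_extChartAt_symm hp)

theorem chartRep_congr {x₀ p : M} {y₀ : N} {G G' : M → N}
    (hp : p ∈ (extChartAt 𝓘(ℝ, E) x₀).source) (hG : G' =ᶠ[𝓝 p] G) :
    chartRep E E' x₀ y₀ G' =ᶠ[𝓝 (extChartAt 𝓘(ℝ, E) x₀ p)] chartRep E E' x₀ y₀ G := by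
  filter_upwards [(tendsto_extChartAt_symm hp).eventually hG] with a ha
  simp only [chartRep, Function.comp_apply, ha]

theorem chartRep_eventuallyEq {x₀ : M} {y₀ : N} {g : E → E'} {G : M → N} {O : Set E}
    (hO : IsOpen O) (hφ : O ⊆ (extChartAt 𝓘(ℝ, E) x₀).target)
    (hψ : MapsTo g O (extChartAt 𝓘(ℝ, E') y₀).target)
    (hG : EqOn G ((extChartAt 𝓘(ℝ, E') y₀).symm ∘ g ∘ extChartAt 𝓘(ℝ, E) x₀)
      ((extChartAt 𝓘(ℝ, E) x₀).source ∩ extChartAt 𝓘(ℝ, E) x₀ ⁻¹' O)) {a : E} (ha : a ∈ O) :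
    chartRep E E' x₀ y₀ G =ᶠ[𝓝 a] g := by
  filter_upwards [hO.mem_nhds ha] with b hb
  have hb' := (extChartAt 𝓘(ℝ, E) x₀).right_inv (hφ hb)
  have := hG ⟨(extChartAt 𝓘(ℝ, E) x₀).map_target (hφ hb), by rwa [mem_preimage, hb']⟩
  simp only [Function.comp_apply, hb'] at this
  simp only [chartRep, Function.comp_apply, this, (extChartAt 𝓘(ℝ, E') y₀).right_inv (hψ hb)]

variable [IsManifold 𝓘(ℝ, E) ∞ M] [IsManifold 𝓘(ℝ, E') ∞ N] {x₀ p : M} {y₀ : N} {G : M → N}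

theorem contDiffAt_chartRep (hp : p ∈ (extChartAt 𝓘(ℝ, E) x₀).source)
    (hGp : G p ∈ (extChartAt 𝓘(ℝ, E') y₀).source) (hG : ContMDiffAt 𝓘(ℝ, E) 𝓘(ℝ, E') ∞ G p) :
    ContDiffAt ℝ ∞ (chartRep E E' x₀ y₀ G) (extChartAt 𝓘(ℝ, E) x₀ p) := by
  rw [extChartAt_source] at hp hGp
  simpa [chartRep, contDiffWithinAt_univ] using ((contMDiffAt_iff_of_mem_source hp hGp).1 hG).2

theorem contMDiffAt_of_eventuallyEq_extChartAt {h : E → E'}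
    (hp : p ∈ (extChartAt 𝓘(ℝ, E) x₀).source)
    (hhp : h (extChartAt 𝓘(ℝ, E) x₀ p) ∈ (extChartAt 𝓘(ℝ, E') y₀).target)
    (hh : ContDiffAt ℝ ∞ h (extChartAt 𝓘(ℝ, E) x₀ p))
    (hG : G =ᶠ[𝓝 p] (extChartAt 𝓘(ℝ, E') y₀).symm ∘ h ∘ extChartAt 𝓘(ℝ, E) x₀) :
    ContMDiffAt 𝓘(ℝ, E) 𝓘(ℝ, E') ∞ G p := by
  have hψ : ContMDiffAt 𝓘(ℝ, E') 𝓘(ℝ, E') ∞ (extChartAt 𝓘(ℝ, E') y₀).symm _ :=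
    (contMDiffOn_extChartAt_symm y₀).contMDiffAt ((isOpen_extChartAt_target y₀).mem_nhds hhp)
  have hφ : ContMDiffAt 𝓘(ℝ, E) 𝓘(ℝ, E) ∞ (extChartAt 𝓘(ℝ, E) x₀) p :=
    contMDiffAt_extChartAt' (by rwa [← extChartAt_source 𝓘(ℝ, E)])
  exact (hψ.comp p (hh.contMDiffAt.comp p hφ)).congr_of_eventuallyEq hG

end ChartRep

section ChartRepLipschitz

variable {E : Type*} [NormedAddCommGroup E] [NormedSpace ℝ E]
  {E' : Type*} [NormedAddCommGroup E'] [NormedSpace ℝ E']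
  {M : Type*} [EMetricSpace M] [ChartedSpace E M]
  {N : Type*} [EMetricSpace N] [ChartedSpace E' N]

theorem IsDistNormAt.exists_nhds_edist_le {x₀ p : M} {ν : Seminorm ℝ E} (hν : IsDistNormAt x₀ p ν)
    (hp : p ∈ (extChartAt 𝓘(ℝ, E) x₀).source) {r : ℝ≥0} (hr : 1 < r) :
    ∃ s ∈ 𝓝 (extChartAt 𝓘(ℝ, E) x₀ p), s ⊆ (extChartAt 𝓘(ℝ, E) x₀).target ∧ ∀ a ∈ s, ∀ b ∈ s,
      edist ((extChartAt 𝓘(ℝ, E) x₀).symm a) ((extChartAt 𝓘(ℝ, E) x₀).symm b) ≤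
        r * ENNReal.ofReal (ν (b - a)) ∧
      ENNReal.ofReal (ν (b - a)) ≤
        r * edist ((extChartAt 𝓘(ℝ, E) x₀).symm a) ((extChartAt 𝓘(ℝ, E) x₀).symm b) := by
  have h := (hν.eventually_edist_le r hr).and (hν.eventually_le_edist r hr)
  rw [nhds_prod_eq] at h
  obtain ⟨V, hV, hVr⟩ := eventually_prod_self_iff'.1 h
  refine ⟨(extChartAt 𝓘(ℝ, E) x₀).target ∩ (extChartAt 𝓘(ℝ, E) x₀).symm ⁻¹' V,
    inter_mem (extChartAt_target_mem_nhds' ((extChartAt 𝓘(ℝ, E) x₀).map_source hp))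
      (tendsto_extChartAt_symm hp hV), inter_subset_left, fun a ha b hb ↦ ?_⟩
  simpa only [(extChartAt 𝓘(ℝ, E) x₀).right_inv ha.1,
    (extChartAt 𝓘(ℝ, E) x₀).right_inv hb.1] using hVr _ ha.2 _ hb.2

theorem exists_nhds_seminorm_chartRep_le {x₀ p : M} {y₀ : N} {G : M → N}
    (hp : p ∈ (extChartAt 𝓘(ℝ, E) x₀).source)
    {ν : Seminorm ℝ E} (hν : IsDistNormAt x₀ p ν) {ν' : Seminorm ℝ E'}
    (hν' : IsDistNormAt y₀ (G p) ν') {K K₁ : ℝ≥0} (hK : K < K₁) {U : Set M} (hU : U ∈ 𝓝 p)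
    (hG : LipschitzOnWith K G U) :
    ∃ s ∈ 𝓝 (extChartAt 𝓘(ℝ, E) x₀ p), ∀ a ∈ s, ∀ b ∈ s,
      ν' (chartRep E E' x₀ y₀ G b - chartRep E E' x₀ y₀ G a) ≤ K₁ * ν (b - a) := by
  obtain ⟨r, hr, hrK⟩ := exists_one_lt_sq_mul_lt hK
  set φ := extChartAt 𝓘(ℝ, E) x₀
  have hφ := tendsto_extChartAt_symm hp
  have hGc : Tendsto G (𝓝 p) (𝓝 (G p)) := hG.continuousOn.continuousAt hU
  obtain ⟨s, hs, -, hsr⟩ := hν.exists_nhds_edist_le hp hr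
  have hν'r := hν'.eventually_le_edist r hr
  rw [nhds_prod_eq] at hν'r
  obtain ⟨V, hV, hVr⟩ := eventually_prod_self_iff'.1 hν'r
  refine ⟨s ∩ φ.symm ⁻¹' (U ∩ G ⁻¹' V), inter_mem hs (hφ (inter_mem hU (hGc hV))),
    fun a ha b hb ↦ ?_⟩
  have hle : ENNReal.ofReal (ν' (chartRep E E' x₀ y₀ G b - chartRep E E' x₀ y₀ G a)) ≤
      (r * r * K : ℝ≥0) * ENNReal.ofReal (ν (b - a)) :=
    calc _ ≤ r * edist (G (φ.symm a)) (G (φ.symm b)) := hVr _ ha.2.2 _ hb.2.2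
      _ ≤ r * (K * (r * ENNReal.ofReal (ν (b - a)))) := by
          gcongr
          exact (hG ha.2.1 hb.2.1).trans (by gcongr; exact (hsr a ha.1 b hb.1).1)
      _ = _ := by push_cast; ring
  rw [ofReal_le_coe_mul_ofReal (apply_nonneg ν _)] at hle
  have := apply_nonneg ν (b - a)
  exact hle.trans (by gcongr)

theorem exists_lipschitzOnWith_chartRep {x₀ p : M} {y₀ : N} {G : M → N}
    (hp : p ∈ (extChartAt 𝓘(ℝ, E) x₀).source)
    {ν : Seminorm ℝ E} (hν : IsDistNormAt x₀ p ν) {ν' : Seminorm ℝ E'}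
    (hν' : IsDistNormAt y₀ (G p) ν') {K : ℝ≥0} {U : Set M} (hU : U ∈ 𝓝 p)
    (hG : LipschitzOnWith K G U) :
    ∃ K', ∃ s ∈ 𝓝 (extChartAt 𝓘(ℝ, E) x₀ p), LipschitzOnWith K' (chartRep E E' x₀ y₀ G) s := by
  obtain ⟨s, hs, hle⟩ := exists_nhds_seminorm_chartRep_le hp hν hν' (lt_add_one K) hU hG
  obtain ⟨C, hC, hνC, -⟩ := hν.exists_norm_equiv
  obtain ⟨C', hC', -, hνC'⟩ := hν'.exists_norm_equiv
  refine ⟨(C' * ((K + 1 : ℝ≥0) * C)).toNNReal, s, hs,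
    LipschitzOnWith.of_dist_le_mul fun b hb a ha ↦ ?_⟩
  rw [dist_eq_norm, dist_eq_norm, Real.coe_toNNReal _ (by positivity)]
  calc _ ≤ C' * ν' (chartRep E E' x₀ y₀ G b - chartRep E E' x₀ y₀ G a) := hνC' _
    _ ≤ C' * ((K + 1 : ℝ≥0) * (C * ‖b - a‖)) := by
        gcongr
        exact (hle a ha b hb).trans (by gcongr; exact hνC _)
    _ = _ := by ring

end ChartRepLipschitz

section ChartIndependence

variable {E : Type*} [NormedAddCommGroup E] [NormedSpace ℝ E]
  {E' : Type*} [NormedAddCommGroup E'] [NormedSpace ℝ E']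
  {M : Type*} [EMetricSpace M] [ChartedSpace E M] [IsManifold 𝓘(ℝ, E) ∞ M]
  [RiemannianBundle (fun x : M ↦ TangentSpace 𝓘(ℝ, E) x)]
  [IsContinuousRiemannianBundle E (fun x : M ↦ TangentSpace 𝓘(ℝ, E) x)]
  [IsRiemannianManifold 𝓘(ℝ, E) M]
  {N : Type*} [EMetricSpace N] [ChartedSpace E' N] [IsManifold 𝓘(ℝ, E') ∞ N]
  [RiemannianBundle (fun x : N ↦ TangentSpace 𝓘(ℝ, E') x)]
  [IsContinuousRiemannianBundle E' (fun x : N ↦ TangentSpace 𝓘(ℝ, E') x)]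
  [IsRiemannianManifold 𝓘(ℝ, E') N]
  {x₀ x₁ p : M} {y₀ y₁ : N} {G : M → N} {K : ℝ≥0} {U : Set M}

theorem exists_lipschitzOnWith_chartRep_of_mem_source (hU : U ∈ 𝓝 p) (hG : LipschitzOnWith K G U)
    (hx₀ : p ∈ (extChartAt 𝓘(ℝ, E) x₀).source) (hy₀ : G p ∈ (extChartAt 𝓘(ℝ, E') y₀).source) :
    ∃ K', ∃ s ∈ 𝓝 (extChartAt 𝓘(ℝ, E) x₀ p), LipschitzOnWith K' (chartRep E E' x₀ y₀ G) s := by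
  obtain ⟨ν, hν⟩ := exists_isDistNormAt hx₀
  obtain ⟨ν', hν'⟩ := exists_isDistNormAt hy₀
  exact exists_lipschitzOnWith_chartRep hx₀ hν hν' hU hG

namespace ConvexlyExpandingAt

theorem chartRep_change_source (hU : U ∈ 𝓝 p) (hG : LipschitzOnWith K G U)
    (hx₀ : p ∈ (extChartAt 𝓘(ℝ, E) x₀).source) (hy₀ : G p ∈ (extChartAt 𝓘(ℝ, E') y₀).source)
    (h : ConvexlyExpandingAt (chartRep E E' x₀ y₀ G) (extChartAt 𝓘(ℝ, E) x₀ p))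
    (hx₁ : p ∈ (extChartAt 𝓘(ℝ, E) x₁).source) :
    ConvexlyExpandingAt (chartRep E E' x₁ y₀ G) (extChartAt 𝓘(ℝ, E) x₁ p) := by
  obtain ⟨T, hT⟩ := exists_hasStrictFDerivAt_coordChange hx₁ hx₀
  obtain ⟨K₀, s, hs, hlip⟩ := exists_lipschitzOnWith_chartRep_of_mem_source hU hG hx₀ hy₀
  have hp : (extChartAt 𝓘(ℝ, E) x₀ ∘ (extChartAt 𝓘(ℝ, E) x₁).symm) (extChartAt 𝓘(ℝ, E) x₁ p) =
      extChartAt 𝓘(ℝ, E) x₀ p := by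
    rw [Function.comp_apply, (extChartAt 𝓘(ℝ, E) x₁).left_inv hx₁]
  rw [← hp] at h hs
  refine (h.comp_right hs hlip hT).congr ?_
  filter_upwards [(tendsto_extChartAt_symm hx₁).eventually
    ((isOpen_extChartAt_source x₀).mem_nhds hx₀)] with a ha
  simp only [chartRep, Function.comp_apply, (extChartAt 𝓘(ℝ, E) x₀).left_inv ha]

theorem chartRep_change_target (hU : U ∈ 𝓝 p) (hG : LipschitzOnWith K G U)
    (hx₀ : p ∈ (extChartAt 𝓘(ℝ, E) x₀).source) (hy₀ : G p ∈ (extChartAt 𝓘(ℝ, E') y₀).source)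
    (h : ConvexlyExpandingAt (chartRep E E' x₀ y₀ G) (extChartAt 𝓘(ℝ, E) x₀ p))
    (hy₁ : G p ∈ (extChartAt 𝓘(ℝ, E') y₁).source) :
    ConvexlyExpandingAt (chartRep E E' x₀ y₁ G) (extChartAt 𝓘(ℝ, E) x₀ p) := by
  obtain ⟨T, hT⟩ := exists_hasStrictFDerivAt_coordChange hy₀ hy₁
  obtain ⟨K₀, s, hs, hlip⟩ := exists_lipschitzOnWith_chartRep_of_mem_source hU hG hx₀ hy₀
  rw [← chartRep_extChartAt hx₀] at hT
  refine (h.comp_left hs hlip hT).congr ?_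
  have hGc : Tendsto G (𝓝 p) (𝓝 (G p)) := hG.continuousOn.continuousAt hU
  filter_upwards [(tendsto_extChartAt_symm hx₀).eventually
    (hGc.eventually ((isOpen_extChartAt_source y₀).mem_nhds hy₀))] with a ha
  simp only [chartRep, Function.comp_apply, (extChartAt 𝓘(ℝ, E') y₀).left_inv ha]

theorem chartRep_of_chartRep (hU : U ∈ 𝓝 p) (hG : LipschitzOnWith K G U)
    (hx₀ : p ∈ (extChartAt 𝓘(ℝ, E) x₀).source) (hy₀ : G p ∈ (extChartAt 𝓘(ℝ, E') y₀).source)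
    (h : ConvexlyExpandingAt (chartRep E E' x₀ y₀ G) (extChartAt 𝓘(ℝ, E) x₀ p))
    (hx₁ : p ∈ (extChartAt 𝓘(ℝ, E) x₁).source) (hy₁ : G p ∈ (extChartAt 𝓘(ℝ, E') y₁).source) :
    ConvexlyExpandingAt (chartRep E E' x₁ y₁ G) (extChartAt 𝓘(ℝ, E) x₁ p) :=
  (h.chartRep_change_source hU hG hx₀ hy₀ hx₁).chartRep_change_target hU hG hx₁ hy₀ hy₁

end ConvexlyExpandingAt

end ChartIndependence

section IncrementSet

variable {E : Type*} [NormedAddCommGroup E] [NormedSpace ℝ E]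
  {E' : Type*} [NormedAddCommGroup E'] [NormedSpace ℝ E']

/-- The increments `w` allowed for a map along the displacement `v`: the map is `K`-Lipschitz with
respect to `ν` and `ν'`, and expands by the factor `c` in the direction `l v`. Both conditions are
convex in `w`, so they survive averaging over translates. -/
def incrementSet (ν : Seminorm ℝ E) (ν' : Seminorm ℝ E') (K c : ℝ) (l : E → E' →L[ℝ] ℝ) (v : E) :
    Set E' :=
  {w | ν' w ≤ K * ν v} ∩ {w | c * ‖v‖ ≤ l v w}

variable {ν : Seminorm ℝ E} {ν' : Seminorm ℝ E'} {K c : ℝ} {l : E → E' →L[ℝ] ℝ} {v : E}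

theorem convex_incrementSet : Convex ℝ (incrementSet ν ν' K c l v) := by
  refine Convex.inter ?_ (convex_halfSpace_ge (l v).isLinear _)
  simpa using ν'.convexOn.convex_le (K * ν v)

theorem isClosed_incrementSet {C : ℝ} (hν' : ∀ w, ν' w ≤ C * ‖w‖) :
    IsClosed (incrementSet ν ν' K c l v) := by
  have hcont : Continuous ν' :=
    (LipschitzWith.of_dist_le_mul (K := C.toNNReal) fun a b ↦ by
      rw [Real.dist_eq, dist_eq_norm]
      refine (abs_sub_map_le_sub ν' a b).trans ((hν' _).trans ?_)
      gcongr
      exact C.le_coe_toNNReal).continuous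
  exact (isClosed_le hcont continuous_const).inter (isClosed_le continuous_const (l v).continuous)

theorem mem_incrementSet_of_norm_sub_le {C C' δ K' c' : ℝ} (hC' : 0 ≤ C') (hδ : 0 ≤ δ)
    (hν : ‖v‖ ≤ C * ν v) (hν' : ∀ w, ν' w ≤ C' * ‖w‖) (hl : ‖l v‖ ≤ 1)
    (hK : K + C' * δ * C ≤ K') (hc : c' ≤ c - δ) {w w' : E'}
    (hw : w ∈ incrementSet ν ν' K c l v) (hww' : ‖w' - w‖ ≤ δ * ‖v‖) :
    w' ∈ incrementSet ν ν' K' c' l v := by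
  obtain ⟨hwK : ν' w ≤ K * ν v, hwc : c * ‖v‖ ≤ l v w⟩ := hw
  constructor
  · change ν' w' ≤ K' * ν v
    have := apply_nonneg ν v
    calc ν' w' ≤ ν' w + ν' (w' - w) := by simpa using map_add_le_add ν' w (w' - w)
      _ ≤ K * ν v + C' * (δ * (C * ν v)) := by
          gcongr
          exact (hν' _).trans (by gcongr; exact hww'.trans (by gcongr))
      _ = (K + C' * δ * C) * ν v := by ring
      _ ≤ K' * ν v := by gcongr
  · change c' * ‖v‖ ≤ l v w'
    have herror : |l v (w' - w)| ≤ 1 * (δ * ‖v‖) := (l v).le_of_opNorm_le_of_le hl hww'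
    rw [map_sub] at herror
    nlinarith [(abs_le.1 herror).1, norm_nonneg v]

theorem convexlyExpandingAt_of_sub_mem_incrementSet {g : E → E'} {O : Set E} {a : E}
    (hO : O ∈ 𝓝 a) (hc : 0 < c) (hl : ∀ v, ‖l v‖ ≤ 1)
    (hinc : ∀ a ∈ O, ∀ b ∈ O, g b - g a ∈ incrementSet ν ν' K c l (b - a)) :
    ConvexlyExpandingAt g a := by
  refine ⟨c, hc, O, hO, fun v ↦ ⟨l v, hl v, fun y hy hyv ↦ ?_⟩⟩
  have hle : c * ‖y + v - y‖ ≤ l (y + v - y) (g (y + v) - g y) := (hinc y hy _ hyv).2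
  rwa [add_sub_cancel_left] at hle

end IncrementSet

section Admissible

variable {E : Type*} [NormedAddCommGroup E] [NormedSpace ℝ E]
  {E' : Type*} [NormedAddCommGroup E'] [NormedSpace ℝ E']
  {M : Type*} [EMetricSpace M] [ChartedSpace E M]
  {N : Type*} [EMetricSpace N] [ChartedSpace E' N]

variable (E E') in
/-- Near `p` the map `G` is Lipschitz with constant smaller than `L`, and it is convexly expanding
in all charts. This is the property of a nonsingular Lipschitz map that survives smoothing. -/
def IsAdmissibleAt (L : ℝ≥0) (G : M → N) (p : M) : Prop :=
  (∃ K < L, ∃ U ∈ 𝓝 p, LipschitzOnWith K G U) ∧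
    ∀ x₀ y₀, p ∈ (extChartAt 𝓘(ℝ, E) x₀).source → G p ∈ (extChartAt 𝓘(ℝ, E') y₀).source →
      ConvexlyExpandingAt (chartRep E E' x₀ y₀ G) (extChartAt 𝓘(ℝ, E) x₀ p)

namespace IsAdmissibleAt

variable {L : ℝ≥0} {G G' : M → N} {x₀ p : M} {y₀ : N}

theorem continuousAt (h : IsAdmissibleAt E E' L G p) : ContinuousAt G p := by
  obtain ⟨⟨K, -, U, hU, hG⟩, -⟩ := h
  exact hG.continuousOn.continuousAt hU

theorem congr (h : IsAdmissibleAt E E' L G p) (hG : G' =ᶠ[𝓝 p] G) :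
    IsAdmissibleAt E E' L G' p := by
  obtain ⟨⟨K, hK, U, hU, hGU⟩, hexp⟩ := h
  obtain ⟨V, hV, hGV⟩ := hG.exists_mem
  refine ⟨⟨K, hK, U ∩ V, inter_mem hU hV, fun a ha b hb ↦ ?_⟩, fun x₀ y₀ hx hy ↦ ?_⟩
  · rw [hGV ha.2, hGV hb.2]
    exact hGU ha.1 hb.1
  · rw [hG.eq_of_nhds] at hy
    exact (hexp x₀ y₀ hx hy).congr (chartRep_congr hx hG)

theorem exists_sub_mem_incrementSet (h : IsAdmissibleAt E E' L G p) {ν : Seminorm ℝ E}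
    {ν' : Seminorm ℝ E'} (hp : p ∈ (extChartAt 𝓘(ℝ, E) x₀).source)
    (hGp : G p ∈ (extChartAt 𝓘(ℝ, E') y₀).source) (hν : IsDistNormAt x₀ p ν)
    (hν' : IsDistNormAt y₀ (G p) ν') :
    ∃ K < L, ∃ c > 0, ∃ l : E → E' →L[ℝ] ℝ, (∀ v, ‖l v‖ ≤ 1) ∧
      ∃ s ∈ 𝓝 (extChartAt 𝓘(ℝ, E) x₀ p), ∀ a ∈ s, ∀ b ∈ s,
        chartRep E E' x₀ y₀ G b - chartRep E E' x₀ y₀ G a ∈ incrementSet ν ν' K c l (b - a) := by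
  obtain ⟨⟨K, hKL, U, hU, hG⟩, hexp⟩ := h
  obtain ⟨c, hc, s, hs, hsc⟩ := hexp x₀ y₀ hp hGp
  choose l hl hlc using hsc
  obtain ⟨K₁, hK₁, hK₁L⟩ := exists_between hKL
  obtain ⟨t, ht, htK⟩ := exists_nhds_seminorm_chartRep_le hp hν hν' hK₁ hU hG
  refine ⟨K₁, hK₁L, c, hc, l, hl, s ∩ t, inter_mem hs ht, fun a ha b hb ↦
    ⟨htK a ha.2 b hb.2, ?_⟩⟩
  simpa only [add_sub_cancel, mem_ofPred_eq] using
    hlc (b - a) a ha.1 (by simpa only [add_sub_cancel] using hb.1)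

end IsAdmissibleAt

/-- A closed convex constraint `S` on the increments over `B` of the chart representation of `G`,
which forces admissibility and tolerates small relative errors: a map that is `δ`-close to `G` on
`B` and satisfies the constraint up to relative error `δ` on an open subset of `B` is admissible
there. -/
structure IsStableConstraint (L : ℝ≥0) (x₀ : M) (y₀ : N) (G : M → N) (B : Set E) (S : E → Set E')
    (δ : ℝ) : Prop where
  convex : ∀ v, Convex ℝ (S v)
  isClosed : ∀ v, IsClosed (S v)
  chartRep_sub_mem : ∀ a ∈ B, ∀ b ∈ B,
    chartRep E E' x₀ y₀ G b - chartRep E E' x₀ y₀ G a ∈ S (b - a)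
  isAdmissibleAt : ∀ (g' : E → E') (G' : M → N) (O : Set E), IsOpen O → O ⊆ B →
    (∀ a ∈ O, ‖g' a - chartRep E E' x₀ y₀ G a‖ ≤ δ) →
    (∀ a ∈ O, ∀ b ∈ O, ∃ w ∈ S (b - a), ‖g' b - g' a - w‖ ≤ δ * ‖b - a‖) →
    EqOn G' ((extChartAt 𝓘(ℝ, E') y₀).symm ∘ g' ∘ extChartAt 𝓘(ℝ, E) x₀)
      ((extChartAt 𝓘(ℝ, E) x₀).source ∩ extChartAt 𝓘(ℝ, E) x₀ ⁻¹' O) →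
    ∀ q ∈ (extChartAt 𝓘(ℝ, E) x₀).source, extChartAt 𝓘(ℝ, E) x₀ q ∈ O →
      IsAdmissibleAt E E' L G' q

section Charts

variable {x₀ : M} {y₀ : N} {g : E → E'} {G : M → N} {O : Set E}

theorem lipschitzOnWith_of_seminorm_sub_le {ν : Seminorm ℝ E} {ν' : Seminorm ℝ E'} {s K : ℝ≥0}
    (hφ : ∀ a ∈ O, ∀ b ∈ O, ENNReal.ofReal (ν (b - a)) ≤
      s * edist ((extChartAt 𝓘(ℝ, E) x₀).symm a) ((extChartAt 𝓘(ℝ, E) x₀).symm b))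
    (hψ : ∀ a ∈ O, ∀ b ∈ O,
      edist ((extChartAt 𝓘(ℝ, E') y₀).symm (g a)) ((extChartAt 𝓘(ℝ, E') y₀).symm (g b)) ≤
        s * ENNReal.ofReal (ν' (g b - g a)))
    (hg : ∀ a ∈ O, ∀ b ∈ O, ν' (g b - g a) ≤ K * ν (b - a))
    (hG : EqOn G ((extChartAt 𝓘(ℝ, E') y₀).symm ∘ g ∘ extChartAt 𝓘(ℝ, E) x₀)
      ((extChartAt 𝓘(ℝ, E) x₀).source ∩ extChartAt 𝓘(ℝ, E) x₀ ⁻¹' O)) :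
    LipschitzOnWith (s * s * K) G
      ((extChartAt 𝓘(ℝ, E) x₀).source ∩ extChartAt 𝓘(ℝ, E) x₀ ⁻¹' O) := by
  set φ := extChartAt 𝓘(ℝ, E) x₀
  intro q hq r hr
  have hqr : ENNReal.ofReal (ν (φ r - φ q)) ≤ s * edist q r := by
    simpa only [φ.left_inv hq.1, φ.left_inv hr.1] using hφ _ hq.2 _ hr.2
  rw [hG hq, hG hr]
  calc _ ≤ s * (K * ENNReal.ofReal (ν (φ r - φ q))) := by
        refine (hψ _ hq.2 _ hr.2).trans ?_
        gcongr
        rw [ofReal_le_coe_mul_ofReal (apply_nonneg ν _)]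
        exact hg _ hq.2 _ hr.2
    _ ≤ s * (K * (s * edist q r)) := by gcongr
    _ = _ := by push_cast; ring

end Charts

variable [IsManifold 𝓘(ℝ, E) ∞ M]
  [RiemannianBundle (fun x : M ↦ TangentSpace 𝓘(ℝ, E) x)]
  [IsContinuousRiemannianBundle E (fun x : M ↦ TangentSpace 𝓘(ℝ, E) x)]
  [IsRiemannianManifold 𝓘(ℝ, E) M]
  [IsManifold 𝓘(ℝ, E') ∞ N]
  [RiemannianBundle (fun x : N ↦ TangentSpace 𝓘(ℝ, E') x)]
  [IsContinuousRiemannianBundle E' (fun x : N ↦ TangentSpace 𝓘(ℝ, E') x)]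
  [IsRiemannianManifold 𝓘(ℝ, E') N]

theorem exists_nhds_isAdmissibleAt {x₀ p : M} {y₀ p' : N} {ν : Seminorm ℝ E} {ν' : Seminorm ℝ E'}
    {K L : ℝ≥0} (hKL : K < L) (hp : p ∈ (extChartAt 𝓘(ℝ, E) x₀).source)
    (hp' : p' ∈ (extChartAt 𝓘(ℝ, E') y₀).source) (hν : IsDistNormAt x₀ p ν)
    (hν' : IsDistNormAt y₀ p' ν') :
    ∃ B ∈ 𝓝 (extChartAt 𝓘(ℝ, E) x₀ p), ∃ B' ∈ 𝓝 (extChartAt 𝓘(ℝ, E') y₀ p'),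
      ∀ (g : E → E') (G : M → N) (O : Set E) (c : ℝ) (l : E → E' →L[ℝ] ℝ), IsOpen O → O ⊆ B →
        MapsTo g O B' → 0 < c → (∀ v, ‖l v‖ ≤ 1) →
        (∀ a ∈ O, ∀ b ∈ O, g b - g a ∈ incrementSet ν ν' K c l (b - a)) →
        EqOn G ((extChartAt 𝓘(ℝ, E') y₀).symm ∘ g ∘ extChartAt 𝓘(ℝ, E) x₀)
          ((extChartAt 𝓘(ℝ, E) x₀).source ∩ extChartAt 𝓘(ℝ, E) x₀ ⁻¹' O) →
        ∀ q ∈ (extChartAt 𝓘(ℝ, E) x₀).source, extChartAt 𝓘(ℝ, E) x₀ q ∈ O →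
          IsAdmissibleAt E E' L G q := by
  obtain ⟨s, hs, hsL⟩ := exists_one_lt_sq_mul_lt hKL
  obtain ⟨B, hB, hBtarget, hBs⟩ := hν.exists_nhds_edist_le hp hs
  obtain ⟨B', hB', hB'target, hB's⟩ := hν'.exists_nhds_edist_le hp' hs
  refine ⟨B, hB, B', hB', fun g G O c l hO hOB hgO hc hl hinc hG q hq hqO ↦ ?_⟩
  have hnhds : (extChartAt 𝓘(ℝ, E) x₀).source ∩ extChartAt 𝓘(ℝ, E) x₀ ⁻¹' O ∈ 𝓝 q :=
    inter_mem ((isOpen_extChartAt_source x₀).mem_nhds hq)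
      ((continuousAt_extChartAt' hq).preimage_mem_nhds (hO.mem_nhds hqO))
  have hlip := lipschitzOnWith_of_seminorm_sub_le
    (fun a ha b hb ↦ (hBs a (hOB ha) b (hOB hb)).2)
    (fun a ha b hb ↦ (hB's _ (hgO ha) _ (hgO hb)).1) (fun a ha b hb ↦ (hinc a ha b hb).1) hG
  have hGq : G q ∈ (extChartAt 𝓘(ℝ, E') y₀).source := by
    rw [hG ⟨hq, hqO⟩]
    exact (extChartAt 𝓘(ℝ, E') y₀).map_target (hB'target (hgO hqO))
  refine ⟨⟨s * s * K, hsL, _, hnhds, hlip⟩, fun x₁ y₁ hx₁ hy₁ ↦ ?_⟩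
  refine ConvexlyExpandingAt.chartRep_of_chartRep hnhds hlip hq hGq ?_ hx₁ hy₁
  exact (convexlyExpandingAt_of_sub_mem_incrementSet (hO.mem_nhds hqO) hc hl hinc).congr
    (chartRep_eventuallyEq hO (hOB.trans hBtarget) (fun a ha ↦ hB'target (hgO ha)) hG hqO)

theorem IsAdmissibleAt.exists_isStableConstraint {L : ℝ≥0} {G : M → N} {x₀ p : M} {y₀ : N}
    (h : IsAdmissibleAt E E' L G p) (hp : p ∈ (extChartAt 𝓘(ℝ, E) x₀).source)
    (hGp : G p ∈ (extChartAt 𝓘(ℝ, E') y₀).source) :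
    ∃ B ∈ 𝓝 (extChartAt 𝓘(ℝ, E) x₀ p), ∃ S : E → Set E',
      ∃ δ > 0, IsStableConstraint L x₀ y₀ G B S δ := by
  obtain ⟨ν, hν⟩ := exists_isDistNormAt hp
  obtain ⟨ν', hν'⟩ := exists_isDistNormAt hGp
  obtain ⟨K, hKL, c, hc, l, hl, s, hs, hinc⟩ := h.exists_sub_mem_incrementSet hp hGp hν hν'
  obtain ⟨K', hKK', hK'L⟩ := exists_between hKL
  obtain ⟨B, hB, B', hB', hadm⟩ := exists_nhds_isAdmissibleAt hK'L hp hGp hν hν'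
  obtain ⟨C, hC, -, hCν⟩ := hν.exists_norm_equiv
  obtain ⟨C', hC', hν'C', -⟩ := hν'.exists_norm_equiv
  obtain ⟨ρ, hρ, hρB'⟩ := Metric.mem_nhds_iff.1 hB'
  have hclose : ∀ᶠ a in 𝓝 (extChartAt 𝓘(ℝ, E) x₀ p), chartRep E E' x₀ y₀ G a ∈
      ball (extChartAt 𝓘(ℝ, E') y₀ (G p)) (ρ / 2) := by
    refine (continuousAt_chartRep hp hGp h.continuousAt).eventually ?_
    rw [chartRep_extChartAt hp]
    exact ball_mem_nhds _ (half_pos hρ)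
  have hgap : (0 : ℝ) < K' - K := sub_pos.2 (by exact_mod_cast hKK')
  obtain ⟨δ, hδ, hδρ, hδc, hδK⟩ : ∃ δ > 0, δ < ρ / 2 ∧ δ < c / 2 ∧ δ < (K' - K) / (C' * C) := by
    obtain ⟨δ, hδ, hδ'⟩ := exists_between
      (show 0 < min (ρ / 2) (min (c / 2) ((K' - K) / (C' * C))) by positivity)
    simp only [lt_min_iff] at hδ'
    exact ⟨δ, hδ, hδ'⟩
  refine ⟨B ∩ s ∩ {a | chartRep E E' x₀ y₀ G a ∈ ball (extChartAt 𝓘(ℝ, E') y₀ (G p)) (ρ / 2)},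
    inter_mem (inter_mem hB hs) hclose, incrementSet ν ν' K c l, δ, hδ,
    fun v ↦ convex_incrementSet, fun v ↦ isClosed_incrementSet hν'C',
    fun a ha b hb ↦ hinc a ha.1.2 b hb.1.2, ?_⟩
  intro g' G' O hO hOB hg' hinc' hG'
  refine hadm g' G' O (c / 2) l hO (fun a ha ↦ (hOB ha).1.1) (fun a ha ↦ hρB' ?_) (half_pos hc) hl
    (fun a ha b hb ↦ ?_) hG'
  · have hdist := hg' a ha
    rw [← dist_eq_norm] at hdist
    exact mem_ball.2 ((dist_triangle _ _ _).trans_lt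
      (by linarith [mem_ball.1 (hOB ha).2] : _ < ρ))
  · obtain ⟨w, hw, hwδ⟩ := hinc' a ha b hb
    refine mem_incrementSet_of_norm_sub_le hC'.le hδ.le (hCν _) hν'C' (hl _) ?_ (by linarith) hw hwδ
    rw [lt_div_iff₀ (by positivity)] at hδK
    linarith

end Admissible

section ChartPatch

variable {E : Type*} [NormedAddCommGroup E] [NormedSpace ℝ E]
  {E' : Type*} [NormedAddCommGroup E'] [NormedSpace ℝ E']
  {M : Type*} [TopologicalSpace M] [ChartedSpace E M]
  {N : Type*} [TopologicalSpace N] [ChartedSpace E' N]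
  {x₀ p : M} {y₀ : N} {C : Set E} {h : E → E'} {G : M → N}

open Classical in
/-- The map `G`, replaced by the map which reads `h` in the charts at `x₀` and `y₀` on the part of
the chart domain at `x₀` which lies over `C`. -/
noncomputable def chartPatch (x₀ : M) (y₀ : N) (C : Set E) (h : E → E') (G : M → N) : M → N :=
  ((extChartAt 𝓘(ℝ, E) x₀).source ∩ extChartAt 𝓘(ℝ, E) x₀ ⁻¹' C).piecewise
    ((extChartAt 𝓘(ℝ, E') y₀).symm ∘ h ∘ extChartAt 𝓘(ℝ, E) x₀) G

theorem chartPatch_eqOn {B : Set E}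
    (hG : MapsTo (G ∘ (extChartAt 𝓘(ℝ, E) x₀).symm) B (extChartAt 𝓘(ℝ, E') y₀).source)
    (hh : ∀ a ∉ C, h a = chartRep E E' x₀ y₀ G a) :
    EqOn (chartPatch x₀ y₀ C h G) ((extChartAt 𝓘(ℝ, E') y₀).symm ∘ h ∘ extChartAt 𝓘(ℝ, E) x₀)
      ((extChartAt 𝓘(ℝ, E) x₀).source ∩ extChartAt 𝓘(ℝ, E) x₀ ⁻¹' B) := by
  classical
  rintro q ⟨hq, hqB⟩
  by_cases hqC : extChartAt 𝓘(ℝ, E) x₀ q ∈ C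
  · exact piecewise_eq_of_mem _ _ _ ⟨hq, hqC⟩
  · have hGq := hG hqB
    rw [Function.comp_apply, (extChartAt 𝓘(ℝ, E) x₀).left_inv hq] at hGq
    rw [chartPatch, piecewise_eq_of_notMem _ _ _ fun h ↦ hqC h.2, Function.comp_apply,
      Function.comp_apply, hh _ hqC, chartRep_extChartAt hq, (extChartAt 𝓘(ℝ, E') y₀).left_inv hGq]

theorem chartPatch_eventuallyEq [T2Space M] (hC : IsCompact C)
    (hCφ : C ⊆ (extChartAt 𝓘(ℝ, E) x₀).target)
    (hp : p ∉ (extChartAt 𝓘(ℝ, E) x₀).source ∩ extChartAt 𝓘(ℝ, E) x₀ ⁻¹' C) :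
    chartPatch x₀ y₀ C h G =ᶠ[𝓝 p] G := by
  classical
  have hclosed : IsClosed
      ((extChartAt 𝓘(ℝ, E) x₀).source ∩ extChartAt 𝓘(ℝ, E) x₀ ⁻¹' C) := by
    rw [← (extChartAt 𝓘(ℝ, E) x₀).symm_image_eq_source_inter_preimage hCφ]
    exact (hC.image_of_continuousOn ((continuousOn_extChartAt_symm x₀).mono hCφ)).isClosed
  filter_upwards [hclosed.isOpen_compl.mem_nhds hp] with q hq
  exact piecewise_eq_of_notMem _ _ _ hq

end ChartPatch

theorem eventually_mem_and_edist_lt_of_isCompact {X Y : Type*} [PseudoMetricSpace X]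
    [PseudoEMetricSpace Y] {K V : Set X} {f : X → Y} (hK : IsCompact K) (hV : IsOpen V)
    (hKV : K ⊆ V) (hf : ContinuousOn f V) {η : ℝ≥0∞} (hη : 0 < η) :
    ∀ᶠ δ in 𝓝 (0 : ℝ), ∀ a ∈ K, ∀ b, dist b a ≤ δ → b ∈ V ∧ edist (f a) (f b) < η := by
  refine hK.eventually_forall_of_forall_eventually fun a ha ↦ ?_
  have hfa : ∀ᶠ b in 𝓝 a, b ∈ V ∧ edist (f b) (f a) < η / 2 :=
    (hV.eventually_mem (hKV ha)).and ((hf.continuousAt (hV.mem_nhds (hKV ha))).eventually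
      (Metric.eball_mem_nhds _ (ENNReal.half_pos hη.ne')))
  obtain ⟨ε, hε, hball⟩ := Metric.mem_nhds_iff.1 hfa
  rw [nhds_prod_eq]
  filter_upwards [prod_mem_prod (Iio_mem_nhds (half_pos hε)) (ball_mem_nhds a (half_pos hε))]
    with ⟨δ, a'⟩ ⟨hδ, ha'⟩ b hb
  have ha'a : a' ∈ ball a ε := ball_subset_ball (half_le_self hε.le) ha'
  have hba : b ∈ ball a ε := mem_ball.2 ((dist_triangle b a' a).trans_lt
    ((add_lt_add_of_le_of_lt (hb.trans hδ.le) ha').trans_eq (add_halves ε)))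
  refine ⟨(hball hba).1, (edist_triangle_right _ _ (f a)).trans_lt ?_⟩
  exact (ENNReal.add_lt_add (hball ha'a).2 (hball hba).2).trans_eq (ENNReal.add_halves η)

section Smoothing

variable {E : Type*} [NormedAddCommGroup E] [NormedSpace ℝ E]
  {E' : Type*} [NormedAddCommGroup E'] [NormedSpace ℝ E']
  {M : Type*} [EMetricSpace M] [ChartedSpace E M]
  {N : Type*} [EMetricSpace N] [ChartedSpace E' N] {L : ℝ≥0} {G : M → N} {x₀ : M} {y₀ : N}

theorem IsStableConstraint.isAdmissibleAt_of_isIncrementAverage {B U : Set E} {S : E → Set E'}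
    {δ : ℝ} (hS : IsStableConstraint L x₀ y₀ G B S δ) {a : E} {r ε : ℝ}
    (hrB : ball a (2 * r) ⊆ B) (hrU : ball a (2 * r) ⊆ U) (hεr : ε ≤ r) (hεδ : ε ≤ δ)
    {h : E → E'} {G' : M → N} (hclose : ∀ a, ‖h a - chartRep E E' x₀ y₀ G a‖ ≤ ε)
    (hinc : IsIncrementAverage (chartRep E E' x₀ y₀ G) h U ε ε)
    (hG' : EqOn G' ((extChartAt 𝓘(ℝ, E') y₀).symm ∘ h ∘ extChartAt 𝓘(ℝ, E) x₀)
      ((extChartAt 𝓘(ℝ, E) x₀).source ∩ extChartAt 𝓘(ℝ, E) x₀ ⁻¹' U))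
    {q : M} (hq : q ∈ (extChartAt 𝓘(ℝ, E) x₀).source)
    (hqa : extChartAt 𝓘(ℝ, E) x₀ q ∈ ball a r) :
    IsAdmissibleAt E E' L G' q := by
  have hball : ∀ y ∈ ball a r, ball y r ⊆ ball a (2 * r) := fun y hy ↦
    ball_subset_ball' (by linarith [mem_ball.1 hy])
  have hr : 0 < r := pos_of_mem_ball hqa
  have hsub : ball a r ⊆ ball a (2 * r) := ball_subset_ball (by linarith)
  refine hS.isAdmissibleAt h G' (ball a r) isOpen_ball (hsub.trans hrB)
    (fun b _ ↦ (hclose b).trans hεδ) (fun y hy z hz ↦ ?_)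
    (hG'.mono (inter_subset_inter_right _ (preimage_mono (hsub.trans hrU)))) q hq hqa
  refine hinc.mono hεr hεδ (S (z - y)) (hS.convex _) (hS.isClosed _) y z
    ((hball y hy).trans hrU) ((hball z hz).trans hrU) fun w hw ↦ ?_
  have hshift : ∀ y ∈ ball a r, y - w ∈ B := fun y hy ↦
    hrB (hball y hy (by simpa [mem_ball, dist_eq_norm] using hw))
  simpa only [sub_sub_sub_cancel_right] using
    hS.chartRep_sub_mem _ (hshift y hy) _ (hshift z hz)

variable [IsManifold 𝓘(ℝ, E) ∞ M]
  [RiemannianBundle (fun x : M ↦ TangentSpace 𝓘(ℝ, E) x)]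
  [IsContinuousRiemannianBundle E (fun x : M ↦ TangentSpace 𝓘(ℝ, E) x)]
  [IsRiemannianManifold 𝓘(ℝ, E) M]
  [IsManifold 𝓘(ℝ, E') ∞ N]
  [RiemannianBundle (fun x : N ↦ TangentSpace 𝓘(ℝ, E') x)]
  [IsContinuousRiemannianBundle E' (fun x : N ↦ TangentSpace 𝓘(ℝ, E') x)]
  [IsRiemannianManifold 𝓘(ℝ, E') N]

theorem eventually_isAdmissibleAt_of_isIncrementAverage (hG : ∀ p, IsAdmissibleAt E E' L G p)
    {K U : Set E} (hK : IsCompact K) (hKU : ∀ a ∈ K, U ∈ 𝓝 a)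
    (hUφ : U ⊆ (extChartAt 𝓘(ℝ, E) x₀).target)
    (hGU : MapsTo (G ∘ (extChartAt 𝓘(ℝ, E) x₀).symm) U (extChartAt 𝓘(ℝ, E') y₀).source) :
    ∀ᶠ ε in 𝓝 (0 : ℝ), ∀ (h : E → E') (G' : M → N),
      (∀ a, ‖h a - chartRep E E' x₀ y₀ G a‖ ≤ ε) →
      IsIncrementAverage (chartRep E E' x₀ y₀ G) h U ε ε →
      EqOn G' ((extChartAt 𝓘(ℝ, E') y₀).symm ∘ h ∘ extChartAt 𝓘(ℝ, E) x₀)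
        ((extChartAt 𝓘(ℝ, E) x₀).source ∩ extChartAt 𝓘(ℝ, E) x₀ ⁻¹' U) →
      ∀ q ∈ (extChartAt 𝓘(ℝ, E) x₀).source ∩ extChartAt 𝓘(ℝ, E) x₀ ⁻¹' K,
        IsAdmissibleAt E E' L G' q := by
  suffices H : ∀ᶠ ε in 𝓝 (0 : ℝ), ∀ a ∈ K, ∀ (h : E → E') (G' : M → N),
      (∀ a, ‖h a - chartRep E E' x₀ y₀ G a‖ ≤ ε) →
      IsIncrementAverage (chartRep E E' x₀ y₀ G) h U ε ε →
      EqOn G' ((extChartAt 𝓘(ℝ, E') y₀).symm ∘ h ∘ extChartAt 𝓘(ℝ, E) x₀)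
        ((extChartAt 𝓘(ℝ, E) x₀).source ∩ extChartAt 𝓘(ℝ, E) x₀ ⁻¹' U) →
      ∀ q ∈ (extChartAt 𝓘(ℝ, E) x₀).source, extChartAt 𝓘(ℝ, E) x₀ q = a →
        IsAdmissibleAt E E' L G' q by
    filter_upwards [H] with ε hε h G' hclose hinc hG' q hq
    exact hε _ hq.2 h G' hclose hinc hG' q hq.1 rfl
  refine hK.eventually_forall_of_forall_eventually fun a ha ↦ ?_
  have haU := mem_of_mem_nhds (hKU a ha)
  obtain ⟨B, hB, S, δ, hδ, hS⟩ := (hG ((extChartAt 𝓘(ℝ, E) x₀).symm a)).exists_isStableConstraint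
    ((extChartAt 𝓘(ℝ, E) x₀).map_target (hUφ haU)) (hGU haU)
  rw [(extChartAt 𝓘(ℝ, E) x₀).right_inv (hUφ haU)] at hB
  obtain ⟨r, hr, hrBU⟩ := Metric.mem_nhds_iff.1 (inter_mem hB (hKU a ha))
  rw [← mul_div_cancel₀ r two_ne_zero] at hrBU
  rw [nhds_prod_eq]
  filter_upwards [prod_mem_prod (Iio_mem_nhds (lt_min (half_pos hr) hδ))
    (ball_mem_nhds a (half_pos hr))] with ⟨ε, a'⟩ ⟨hε, ha'⟩ h G' hclose hinc hG' q hq hqa'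
  obtain ⟨hεr, hεδ⟩ := lt_min_iff.1 (mem_Iio.1 hε)
  exact hS.isAdmissibleAt_of_isIncrementAverage (hrBU.trans inter_subset_left)
    (hrBU.trans inter_subset_right) hεr.le hεδ.le hclose hinc hG' hq (hqa' ▸ ha')

end Smoothing

section SmoothApproximation

variable {E : Type*} [NormedAddCommGroup E] [NormedSpace ℝ E]
  {E' : Type*} [NormedAddCommGroup E'] [NormedSpace ℝ E']
  {M : Type*} [EMetricSpace M] [ChartedSpace E M]
  {N : Type*} [EMetricSpace N] [ChartedSpace E' N]
  {L : ℝ≥0} {F G : M → N}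

theorem exists_closedBall_mapsTo_extChartAt_source (hF : Continuous F) (x₀ : M) :
    ∃ R > 0, closedBall (extChartAt 𝓘(ℝ, E) x₀ x₀) R ⊆ (extChartAt 𝓘(ℝ, E) x₀).target ∧
      ∃ r > 0, ∀ G : M → N, (∀ q, edist (F q) (G q) < r) →
        MapsTo (G ∘ (extChartAt 𝓘(ℝ, E) x₀).symm) (closedBall (extChartAt 𝓘(ℝ, E) x₀ x₀) R)
          (extChartAt 𝓘(ℝ, E') (F x₀)).source := by
  obtain ⟨ε, hε, hεsource⟩ :=
    EMetric.mem_nhds_iff.1 (extChartAt_source_mem_nhds (I := 𝓘(ℝ, E')) (F x₀))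
  have hFx₀ : ∀ᶠ a in 𝓝 (extChartAt 𝓘(ℝ, E) x₀ x₀),
      edist (F ((extChartAt 𝓘(ℝ, E) x₀).symm a)) (F x₀) < ε / 2 :=
    (hF.continuousAt.tendsto.comp (tendsto_extChartAt_symm (mem_extChartAt_source x₀))).eventually
      (Metric.eball_mem_nhds _ (ENNReal.half_pos hε.ne'))
  obtain ⟨R, hR, hRF⟩ := Metric.nhds_basis_closedBall.mem_iff.1
    (inter_mem (extChartAt_target_mem_nhds (I := 𝓘(ℝ, E)) x₀) hFx₀)
  refine ⟨R, hR, fun a ha ↦ (hRF ha).1, ε / 2, ENNReal.half_pos hε.ne', fun G hG a ha ↦ ?_⟩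
  refine hεsource ((edist_triangle_left _ _ (F ((extChartAt 𝓘(ℝ, E) x₀).symm a))).trans_lt ?_)
  exact (ENNReal.add_lt_add (hG _) (hRF ha).2).trans_eq (ENNReal.add_halves ε)

theorem isOpen_extChartAt_source_inter_preimage_ball (x₀ : M) (a : E) (r : ℝ) :
    IsOpen ((extChartAt 𝓘(ℝ, E) x₀).source ∩ extChartAt 𝓘(ℝ, E) x₀ ⁻¹' ball a r) :=
  (continuousOn_extChartAt x₀).isOpen_inter_preimage (isOpen_extChartAt_source x₀) isOpen_ball

variable [FiniteDimensional ℝ E] [FiniteDimensional ℝ E']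
  [IsManifold 𝓘(ℝ, E) ∞ M]
  [RiemannianBundle (fun x : M ↦ TangentSpace 𝓘(ℝ, E) x)]
  [IsContinuousRiemannianBundle E (fun x : M ↦ TangentSpace 𝓘(ℝ, E) x)]
  [IsRiemannianManifold 𝓘(ℝ, E) M]
  [IsManifold 𝓘(ℝ, E') ∞ N]
  [RiemannianBundle (fun x : N ↦ TangentSpace 𝓘(ℝ, E') x)]
  [IsContinuousRiemannianBundle E' (fun x : N ↦ TangentSpace 𝓘(ℝ, E') x)]
  [IsRiemannianManifold 𝓘(ℝ, E') N]

theorem exists_smoothing_chartRep (hG : ∀ p, IsAdmissibleAt E E' L G p) {x₀ : M} {y₀ : N}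
    {a : E} {R : ℝ} (hR : 0 < R) (hRφ : closedBall a R ⊆ (extChartAt 𝓘(ℝ, E) x₀).target)
    (hRG : MapsTo (G ∘ (extChartAt 𝓘(ℝ, E) x₀).symm) (closedBall a R)
      (extChartAt 𝓘(ℝ, E') y₀).source) {η : ℝ≥0∞} (hη : 0 < η) :
    ∃ h : E → E', (∀ b ∉ closedBall a (R / 2), h b = chartRep E E' x₀ y₀ G b) ∧
      (∀ b ∈ closedBall a R, h b ∈ (extChartAt 𝓘(ℝ, E') y₀).target ∧
        edist (G ((extChartAt 𝓘(ℝ, E) x₀).symm b)) ((extChartAt 𝓘(ℝ, E') y₀).symm (h b)) < η) ∧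
      (∀ b ∈ ball a (R / 4), ContDiffAt ℝ ∞ h b) ∧
      (∀ b, ContDiffAt ℝ ∞ (chartRep E E' x₀ y₀ G) b → ContDiffAt ℝ ∞ h b) ∧
      ∀ G' : M → N, EqOn G' ((extChartAt 𝓘(ℝ, E') y₀).symm ∘ h ∘ extChartAt 𝓘(ℝ, E) x₀)
          ((extChartAt 𝓘(ℝ, E) x₀).source ∩ extChartAt 𝓘(ℝ, E) x₀ ⁻¹' closedBall a R) →
        ∀ q ∈ (extChartAt 𝓘(ℝ, E) x₀).source ∩ extChartAt 𝓘(ℝ, E) x₀ ⁻¹' closedBall a (R / 2),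
          IsAdmissibleAt E E' L G' q := by
  have hGc : Continuous G := continuous_iff_continuousAt.2 fun p ↦ (hG p).continuousAt
  set ψ := extChartAt 𝓘(ℝ, E') y₀
  set g := chartRep E E' x₀ y₀ G
  have hgψ : MapsTo g (closedBall a R) ψ.target := fun b hb ↦ ψ.map_source (hRG hb)
  have hg : ContinuousOn g (closedBall a R) := (continuousOn_extChartAt y₀).comp
    (hGc.comp_continuousOn ((continuousOn_extChartAt_symm x₀).mono hRφ)) hRG
  have hadm := eventually_isAdmissibleAt_of_isIncrementAverage hG
    (isCompact_closedBall a (R / 2)) (fun b hb ↦ closedBall_mem_nhds_of_mem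
      (closedBall_subset_ball (half_lt_self hR) hb)) hRφ hRG
  have hedist := eventually_mem_and_edist_lt_of_isCompact
    ((isCompact_closedBall a R).image_of_continuousOn hg) (isOpen_extChartAt_target y₀)
    hgψ.image_subset (continuousOn_extChartAt_symm y₀) hη
  obtain ⟨ε, ⟨hεadm, hεψ⟩, hε : 0 < ε⟩ := (((hadm.and hedist).filter_mono
    nhdsWithin_le_nhds).and (self_mem_nhdsWithin (s := Ioi (0 : ℝ)))).exists
  obtain ⟨h, hhg, hclose, hsmooth, hsmooth', hinc⟩ := exists_local_smoothing hR hg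
    (lt_min hε (half_pos hR)) (min_le_right _ _) hε
  refine ⟨h, hhg, fun b hb ↦ ?_, hsmooth, hsmooth',
    fun G' ↦ hεadm h G' hclose (hinc.mono (min_le_left _ _) le_rfl)⟩
  have hb' := hεψ _ (mem_image_of_mem g hb) _ ((dist_eq_norm _ _).trans_le (hclose b))
  rwa [show ψ.symm (g b) = _ from ψ.left_inv (hRG hb)] at hb'

theorem exists_smoothing_over_ball (hG : ∀ p, IsAdmissibleAt E E' L G p) {x₀ : M} {y₀ : N}
    {a : E} {R : ℝ} (hR : 0 < R) (hRφ : closedBall a R ⊆ (extChartAt 𝓘(ℝ, E) x₀).target)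
    (hRG : MapsTo (G ∘ (extChartAt 𝓘(ℝ, E) x₀).symm) (closedBall a R)
      (extChartAt 𝓘(ℝ, E') y₀).source) {η : ℝ≥0∞} (hη : 0 < η) :
    ∃ G' : M → N, (∀ p, IsAdmissibleAt E E' L G' p) ∧ (∀ q, edist (G q) (G' q) < η) ∧
      (∀ q ∈ (extChartAt 𝓘(ℝ, E) x₀).source ∩ extChartAt 𝓘(ℝ, E) x₀ ⁻¹' ball a (R / 4),
        ContMDiffAt 𝓘(ℝ, E) 𝓘(ℝ, E') ∞ G' q) ∧
      ∀ q, ContMDiffAt 𝓘(ℝ, E) 𝓘(ℝ, E') ∞ G q → ContMDiffAt 𝓘(ℝ, E) 𝓘(ℝ, E') ∞ G' q := by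
  obtain ⟨h, hhg, hclose, hsmooth, hsmooth', hadm⟩ := exists_smoothing_chartRep hG hR hRφ hRG hη
  set φ := extChartAt 𝓘(ℝ, E) x₀
  set ψ := extChartAt 𝓘(ℝ, E') y₀
  set C := closedBall a (R / 2)
  have hCR : C ⊆ ball a R := closedBall_subset_ball (half_lt_self hR)
  set G' := chartPatch x₀ y₀ C h G
  have hG' : EqOn G' (ψ.symm ∘ h ∘ φ) (φ.source ∩ φ ⁻¹' closedBall a R) := chartPatch_eqOn hRG hhg
  have hG'G : ∀ q ∉ φ.source ∩ φ ⁻¹' C, G' =ᶠ[𝓝 q] G := fun q hq ↦ chartPatch_eventuallyEq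
    (isCompact_closedBall _ _) (hCR.trans (ball_subset_closedBall.trans hRφ)) hq
  have hG'smooth : ∀ q ∈ φ.source ∩ φ ⁻¹' ball a R, ContDiffAt ℝ ∞ h (φ q) →
      ContMDiffAt 𝓘(ℝ, E) 𝓘(ℝ, E') ∞ G' q := fun q hq hh ↦ by
    refine contMDiffAt_of_eventuallyEq_extChartAt hq.1 (hclose _ (ball_subset_closedBall hq.2)).1
      hh ?_
    filter_upwards [(isOpen_extChartAt_source_inter_preimage_ball x₀ a R).mem_nhds hq] with z hz
      using hG' ⟨hz.1, ball_subset_closedBall hz.2⟩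
  refine ⟨G', fun q ↦ ?_, fun q ↦ ?_, fun q hq ↦ ?_, fun q hq ↦ ?_⟩
  · by_cases hqC : q ∈ φ.source ∩ φ ⁻¹' C
    · exact hadm G' hG' q hqC
    · exact (hG q).congr (hG'G q hqC)
  · by_cases hqC : q ∈ φ.source ∩ φ ⁻¹' C
    · have hqR : φ q ∈ closedBall a R := ball_subset_closedBall (hCR hqC.2)
      simpa only [hG' ⟨hqC.1, hqR⟩, Function.comp_apply, φ.left_inv hqC.1] using (hclose _ hqR).2
    · rwa [(hG'G q hqC).eq_of_nhds, edist_self]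
  · exact hG'smooth q ⟨hq.1, ball_subset_ball (by linarith) hq.2⟩ (hsmooth _ hq.2)
  · by_cases hqC : q ∈ φ.source ∩ φ ⁻¹' C
    · refine hG'smooth q ⟨hqC.1, hCR hqC.2⟩ (hsmooth' _ (contDiffAt_chartRep hqC.1 ?_ hq))
      simpa only [Function.comp_apply, φ.left_inv hqC.1] using
        hRG (ball_subset_closedBall (hCR hqC.2))
    · exact hq.congr_of_eventuallyEq (hG'G q hqC)

theorem exists_nhds_smoothing (hF : Continuous F) (x₀ : M) :
    ∃ W ∈ 𝓝 x₀, ∃ r > 0, ∀ (L : ℝ≥0) (G : M → N), (∀ p, IsAdmissibleAt E E' L G p) →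
      (∀ q, edist (F q) (G q) < r) → ∀ η : ℝ≥0∞, 0 < η →
      ∃ G' : M → N, (∀ p, IsAdmissibleAt E E' L G' p) ∧ (∀ q, edist (G q) (G' q) < η) ∧
        (∀ q ∈ W, ContMDiffAt 𝓘(ℝ, E) 𝓘(ℝ, E') ∞ G' q) ∧
        ∀ q, ContMDiffAt 𝓘(ℝ, E) 𝓘(ℝ, E') ∞ G q → ContMDiffAt 𝓘(ℝ, E) 𝓘(ℝ, E') ∞ G' q := by
  obtain ⟨R, hR, hRφ, r, hr, hRG⟩ :=
    exists_closedBall_mapsTo_extChartAt_source (E := E) (E' := E') hF x₀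
  exact ⟨_, (isOpen_extChartAt_source_inter_preimage_ball x₀ _ _).mem_nhds
    ⟨mem_extChartAt_source x₀, mem_ball_self (by positivity)⟩, r, hr,
    fun L G hG hFG η hη ↦ exists_smoothing_over_ball hG hR hRφ (hRG G hFG) hη⟩

theorem exists_contMDiff_isAdmissibleAt [CompactSpace M] (hF : ∀ p, IsAdmissibleAt E E' L F p)
    {η : ℝ≥0∞} (hη : 0 < η) :
    ∃ G : M → N, (∀ p, IsAdmissibleAt E E' L G p) ∧ (∀ q, edist (F q) (G q) < η) ∧
      ContMDiff 𝓘(ℝ, E) 𝓘(ℝ, E') ∞ G := by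
  classical
  have hFc : Continuous F := continuous_iff_continuousAt.2 fun p ↦ (hF p).continuousAt
  choose W hW r hr hsmoothing using exists_nhds_smoothing (E := E) (E' := E') hFc
  obtain ⟨t, -, ht⟩ := isCompact_univ.elim_nhds_subcover W fun x _ ↦ hW x
  have hfinite : ∀ (s : Finset M) (η : ℝ≥0∞), 0 < η → ∃ G : M → N,
      (∀ p, IsAdmissibleAt E E' L G p) ∧ (∀ q, edist (F q) (G q) < η) ∧
      ∀ x ∈ s, ∀ q ∈ W x, ContMDiffAt 𝓘(ℝ, E) 𝓘(ℝ, E') ∞ G q := by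
    intro s
    induction s using Finset.induction_on with
    | empty => exact fun η hη ↦ ⟨F, hF, fun q ↦ by rwa [edist_self], by simp⟩
    | insert x s hx ih =>
      intro η hη
      have hη2 : 0 < η / 2 := ENNReal.half_pos hη.ne'
      obtain ⟨G, hG, hFG, hGs⟩ := ih (min (η / 2) (r x)) (lt_min hη2 (hr x))
      obtain ⟨G', hG', hGG', hG'x, hG's⟩ := hsmoothing x L G hG
        (fun q ↦ (hFG q).trans_le (min_le_right _ _)) _ hη2
      refine ⟨G', hG', fun q ↦ ?_, fun y hy q hq ↦ ?_⟩
      · calc edist (F q) (G' q) ≤ edist (F q) (G q) + edist (G q) (G' q) := edist_triangle _ _ _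
          _ < η / 2 + η / 2 :=
            ENNReal.add_lt_add ((hFG q).trans_le (min_le_left _ _)) (hGG' q)
          _ = η := ENNReal.add_halves η
      · rcases Finset.mem_insert.1 hy with rfl | hy
        · exact hG'x q hq
        · exact hG's q (hGs y hy q hq)
  obtain ⟨G, hG, hFG, hGs⟩ := hfinite t η hη
  refine ⟨G, hG, hFG, fun q ↦ ?_⟩
  obtain ⟨x, hx, hq⟩ := mem_iUnion₂.1 (ht (mem_univ q))
  exact hGs x hx q hq

end SmoothApproximation

section LipschitzConstant

variable {X Y : Type*} [EMetricSpace X] [EMetricSpace Y]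

theorem lipschitzConstant_le {f : X → Y} {K : ℝ≥0∞} (h : ∀ x y, edist (f x) (f y) ≤ K * edist x y) :
    lipschitzConstant f ≤ K := by
  refine iSup_le fun x ↦ iSup_le fun y ↦ iSup_le fun _ ↦ ?_
  exact ENNReal.div_le_of_le_mul (h x y)

theorem edist_le_lipschitzConstant_mul (f : X → Y) {x y : X} (hxy : edist x y ≠ ⊤) :
    edist (f x) (f y) ≤ lipschitzConstant f * edist x y := by
  rcases eq_or_ne x y with rfl | hne
  · simp
  rw [← ENNReal.div_le_iff_le_mul (Or.inl (edist_pos.2 hne).ne') (Or.inl hxy)]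
  exact le_iSup_of_le x (le_iSup_of_le y (le_iSup_of_le hne le_rfl))

theorem lipschitzOnWith_eball_lipschitzConstant {f : X → Y} (hf : lipschitzConstant f ≠ ⊤) (p : X) :
    LipschitzOnWith (lipschitzConstant f).toNNReal f (eball p 1) := by
  intro x hx y hy
  rw [ENNReal.coe_toNNReal hf]
  refine edist_le_lipschitzConstant_mul f (ne_top_of_le_ne_top ?_ (edist_triangle_right x y p))
  exact (ENNReal.add_lt_add (mem_eball.1 hx) (mem_eball.1 hy)).ne_top

end LipschitzConstant

section ChartDifferential

variable {E : Type*} [NormedAddCommGroup E] [NormedSpace ℝ E]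
  {E' : Type*} [NormedAddCommGroup E'] [NormedSpace ℝ E']
  {M : Type*} [TopologicalSpace M] [ChartedSpace E M]
  {N : Type*} [TopologicalSpace N] [ChartedSpace E' N]
  {G : M → N} {p : M}

namespace ConvexlyExpandingAt

theorem mfderiv_injective
    (h : ConvexlyExpandingAt (chartRep E E' p (G p) G) (extChartAt 𝓘(ℝ, E) p p))
    (hG : MDifferentiableAt 𝓘(ℝ, E) 𝓘(ℝ, E') G p) :
    Function.Injective (mfderiv 𝓘(ℝ, E) 𝓘(ℝ, E') G p) := by
  have hderiv : HasFDerivWithinAt (chartRep E E' p (G p) G)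
      (show E →L[ℝ] E' from mfderiv 𝓘(ℝ, E) 𝓘(ℝ, E') G p) univ (extChartAt 𝓘(ℝ, E) p p) := by
    rw [← 𝓘(ℝ, E).range_eq_univ]
    exact hG.hasMFDerivAt.2
  exact h.fderiv_injective (hasFDerivWithinAt_univ.1 hderiv)

theorem eventually_eq_of_apply_eq
    (h : ConvexlyExpandingAt (chartRep E E' p (G p) G) (extChartAt 𝓘(ℝ, E) p p)) :
    ∀ᶠ q in 𝓝 p, G q = G p → q = p := by
  obtain ⟨c, hc, hle⟩ := h.eventually_norm_le_norm_sub
  filter_upwards [extChartAt_source_mem_nhds (I := 𝓘(ℝ, E)) p,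
    (continuousAt_extChartAt p).eventually hle] with q hq hqle hGq
  have hp := mem_extChartAt_source (I := 𝓘(ℝ, E)) p
  rw [chartRep_extChartAt hq, chartRep_extChartAt hp, hGq, sub_self, norm_zero] at hqle
  exact (extChartAt 𝓘(ℝ, E) p).injOn hq hp
    (sub_eq_zero.1 (norm_le_zero_iff.1 (nonpos_of_mul_nonpos_right hqle hc)))

end ConvexlyExpandingAt

variable [IsManifold 𝓘(ℝ, E) ∞ M]

theorem mdifferentiableAt_extChartAt_symm {x₀ : M} {a : E}
    (ha : a ∈ (extChartAt 𝓘(ℝ, E) x₀).target) :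
    MDifferentiableAt 𝓘(ℝ, E) 𝓘(ℝ, E) (extChartAt 𝓘(ℝ, E) x₀).symm a := by
  rw [← mdifferentiableWithinAt_univ, ← 𝓘(ℝ, E).range_eq_univ]
  exact mdifferentiableWithinAt_extChartAt_symm ha

variable [IsManifold 𝓘(ℝ, E') ∞ N]

theorem inTangentCoordinates_eq_fderiv_chartRep {x : M}
    (hp : p ∈ (extChartAt 𝓘(ℝ, E) x).source) (hGp : G p ∈ (extChartAt 𝓘(ℝ, E') (G x)).source)
    (hG : MDifferentiableAt 𝓘(ℝ, E) 𝓘(ℝ, E') G p) :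
    inTangentCoordinates 𝓘(ℝ, E) 𝓘(ℝ, E') id G (fun y ↦ mfderiv 𝓘(ℝ, E) 𝓘(ℝ, E') G y) x p =
      fderiv ℝ (chartRep E E' x (G x) G) (extChartAt 𝓘(ℝ, E) x p) := by
  set φ := extChartAt 𝓘(ℝ, E) x
  have hφp : φ.symm (φ p) = p := φ.left_inv hp
  have hφ : MDifferentiableAt 𝓘(ℝ, E) 𝓘(ℝ, E) φ.symm (φ p) :=
    mdifferentiableAt_extChartAt_symm (φ.map_source hp)
  rw [extChartAt_source] at hp hGp
  have hψ := mdifferentiableAt_extChartAt (I := 𝓘(ℝ, E')) hGp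
  rw [inTangentCoordinates_eq_mfderiv_comp (f := id) hp hGp, ← mfderiv_eq_fderiv,
    chartRep, mfderiv_comp_of_eq hψ (hG.comp_of_eq (φ p) hφ hφp) (congrArg G hφp),
    mfderiv_comp_of_eq hG hφ hφp]
  have hφ_within : (show E →L[ℝ] E from mfderivWithin 𝓘(ℝ, E) 𝓘(ℝ, E) φ.symm
      (range 𝓘(ℝ, E)) (φ p)) = (show E →L[ℝ] E from mfderiv 𝓘(ℝ, E) 𝓘(ℝ, E) φ.symm (φ p)) := by
    rw [ModelWithCorners.range_eq_univ, mfderivWithin_univ]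
  -- The tangent spaces at `φ.symm (φ p)` and `p` are distinct types until `E` is made explicit.
  have hbase (z : M) (hz : z = p) (C : E →L[ℝ] E) :
      (show E →L[ℝ] E' from mfderiv 𝓘(ℝ, E') 𝓘(ℝ, E') (extChartAt 𝓘(ℝ, E') (G x)) (G z) ∘SL
        mfderiv 𝓘(ℝ, E) 𝓘(ℝ, E') G z ∘SL C) =
      (show E →L[ℝ] E' from mfderiv 𝓘(ℝ, E') 𝓘(ℝ, E') (extChartAt 𝓘(ℝ, E') (G x)) (G p) ∘SL
        mfderiv 𝓘(ℝ, E) 𝓘(ℝ, E') G p ∘SL C) := by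
    subst hz; rfl
  exact (congrArg (fun C : E →L[ℝ] E ↦ (show E →L[ℝ] E' from
    mfderiv 𝓘(ℝ, E') 𝓘(ℝ, E') (extChartAt 𝓘(ℝ, E') (G x)) (G p) ∘SL
      mfderiv 𝓘(ℝ, E) 𝓘(ℝ, E') G p ∘SL C)) hφ_within).trans (hbase _ hφp _).symm

theorem mdifferentiableAt_of_differentiableAt_chartRep {x₀ : M} {y₀ : N}
    (hGp : ContinuousAt G p) (hp : p ∈ (extChartAt 𝓘(ℝ, E) x₀).source)
    (hy₀ : G p ∈ (extChartAt 𝓘(ℝ, E') y₀).source)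
    (hG : DifferentiableAt ℝ (chartRep E E' x₀ y₀ G) (extChartAt 𝓘(ℝ, E) x₀ p)) :
    MDifferentiableAt 𝓘(ℝ, E) 𝓘(ℝ, E') G p := by
  have hφ : MDifferentiableAt 𝓘(ℝ, E) 𝓘(ℝ, E) (extChartAt 𝓘(ℝ, E) x₀) p :=
    mdifferentiableAt_extChartAt (by rwa [← extChartAt_source 𝓘(ℝ, E)])
  have hψ : MDifferentiableAt 𝓘(ℝ, E') 𝓘(ℝ, E') (extChartAt 𝓘(ℝ, E') y₀).symm
      (chartRep E E' x₀ y₀ G (extChartAt 𝓘(ℝ, E) x₀ p)) := by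
    rw [chartRep_extChartAt hp]
    exact mdifferentiableAt_extChartAt_symm ((extChartAt 𝓘(ℝ, E') y₀).map_source hy₀)
  refine (hψ.comp p (hG.mdifferentiableAt.comp p hφ)).congr_of_eventuallyEq ?_
  filter_upwards [(isOpen_extChartAt_source x₀).mem_nhds hp,
    hGp.preimage_mem_nhds ((isOpen_extChartAt_source y₀).mem_nhds hy₀)] with q hq hGq
  rw [Function.comp_apply, Function.comp_apply, chartRep_extChartAt hq]
  exact ((extChartAt 𝓘(ℝ, E') y₀).left_inv hGq).symm

theorem limitingDerivatives_chartRep_subset (hG : Continuous G) (x : M) :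
    limitingDerivatives (chartRep E E' x (G x) G) (extChartAt 𝓘(ℝ, E) x x) ⊆
      limitingDifferentials 𝓘(ℝ, E) 𝓘(ℝ, E') G x := by
  intro A hA
  obtain ⟨u, hu, hdiff, huA⟩ := exists_seq_of_mem_limitingDerivatives hA
  set φ := extChartAt 𝓘(ℝ, E) x
  have hφu : Tendsto (φ.symm ∘ u) atTop (𝓝 x) :=
    (tendsto_extChartAt_symm (mem_extChartAt_source x)).comp hu
  have hmem : ∀ᶠ i in atTop, u i ∈ φ.target ∧
      G (φ.symm (u i)) ∈ (extChartAt 𝓘(ℝ, E') (G x)).source :=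
    (hu.eventually (extChartAt_target_mem_nhds x)).and
      ((hG.continuousAt.tendsto.comp hφu).eventually (extChartAt_source_mem_nhds (G x)))
  obtain ⟨k, hk⟩ := eventually_atTop.1 hmem
  have hmdiff (i) (hi : k ≤ i) : MDifferentiableAt 𝓘(ℝ, E) 𝓘(ℝ, E') G (φ.symm (u i)) :=
    mdifferentiableAt_of_differentiableAt_chartRep hG.continuousAt (φ.map_target (hk i hi).1)
      (hk i hi).2 (by rw [φ.right_inv (hk i hi).1]; exact hdiff i)
  refine ⟨fun i ↦ φ.symm (u (i + k)), (tendsto_add_atTop_iff_nat k).2 hφu,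
    fun i ↦ hmdiff _ (Nat.le_add_left k i),
    ((tendsto_add_atTop_iff_nat k).2 huA).congr fun i ↦ ?_⟩
  obtain ⟨hφi, hψi⟩ := hk _ (Nat.le_add_left k i)
  rw [inTangentCoordinates_eq_fderiv_chartRep (φ.map_target hφi) hψi
    (hmdiff _ (Nat.le_add_left k i)), φ.right_inv hφi]

end ChartDifferential

section Consequences

variable {E : Type*} [NormedAddCommGroup E] [NormedSpace ℝ E]
  {E' : Type*} [NormedAddCommGroup E'] [NormedSpace ℝ E']
  {M : Type*} [EMetricSpace M] [ChartedSpace E M]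
  {N : Type*} [EMetricSpace N] [ChartedSpace E' N]
  {L : ℝ≥0} {F : M → N} {p : M}

theorem discreteTopology_of_lipschitzConstant_eq_zero (hF : lipschitzConstant F = 0)
    (h : ∀ p, ConvexlyExpandingAt (chartRep E E' p (F p) F) (extChartAt 𝓘(ℝ, E) p p)) :
    DiscreteTopology M := by
  refine discreteTopology_iff_singleton_mem_nhds.2 fun p ↦ ?_
  filter_upwards [(h p).eventually_eq_of_apply_eq (E := E) (E' := E'),
    Metric.eball_mem_nhds p one_pos] with q hq hqp
  refine hq (edist_le_zero.1 ?_)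
  simpa [hF] using edist_le_lipschitzConstant_mul F (ne_top_of_lt (mem_eball.1 hqp))

theorem IsAdmissibleAt.mfderiv_injective (h : IsAdmissibleAt E E' L F p)
    (hF : MDifferentiableAt 𝓘(ℝ, E) 𝓘(ℝ, E') F p) :
    Function.Injective (mfderiv 𝓘(ℝ, E) 𝓘(ℝ, E') F p) :=
  (h.2 p (F p) (mem_extChartAt_source p) (mem_extChartAt_source (F p))).mfderiv_injective hF

theorem lipschitzConstant_le_of_isAdmissibleAt
    [RiemannianBundle (fun x : M ↦ TangentSpace 𝓘(ℝ, E) x)] [IsRiemannianManifold 𝓘(ℝ, E) M]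
    (hL : 0 < L) (h : ∀ p, IsAdmissibleAt E E' L F p) : lipschitzConstant F ≤ L :=
  lipschitzConstant_le <| lipschitzWith_of_locally E hL fun p ↦
    let ⟨⟨_, hK, U, hU, hFU⟩, _⟩ := h p
    ⟨U, hU, hFU.weaken hK.le⟩

end Consequences

section Nonsingular

variable {E : Type*} [NormedAddCommGroup E] [NormedSpace ℝ E]
  {E' : Type*} [NormedAddCommGroup E'] [NormedSpace ℝ E']
  {M : Type*} [EMetricSpace M] [ChartedSpace E M] [IsManifold 𝓘(ℝ, E) ∞ M]
  [RiemannianBundle (fun x : M ↦ TangentSpace 𝓘(ℝ, E) x)]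
  [IsContinuousRiemannianBundle E (fun x : M ↦ TangentSpace 𝓘(ℝ, E) x)]
  [IsRiemannianManifold 𝓘(ℝ, E) M]
  {N : Type*} [EMetricSpace N] [ChartedSpace E' N] [IsManifold 𝓘(ℝ, E') ∞ N]
  [RiemannianBundle (fun x : N ↦ TangentSpace 𝓘(ℝ, E') x)]
  [IsContinuousRiemannianBundle E' (fun x : N ↦ TangentSpace 𝓘(ℝ, E') x)]
  [IsRiemannianManifold 𝓘(ℝ, E') N]

theorem isAdmissibleAt_of_lipschitzConstant_lt {F : M → N} {L : ℝ≥0} (hL : lipschitzConstant F < L)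
    {p : M} (h : ConvexlyExpandingAt (chartRep E E' p (F p) F) (extChartAt 𝓘(ℝ, E) p p)) :
    IsAdmissibleAt E E' L F p := by
  have hlip := lipschitzOnWith_eball_lipschitzConstant hL.ne_top p
  have hball : eball p 1 ∈ 𝓝 p := Metric.eball_mem_nhds p one_pos
  exact ⟨⟨_, ENNReal.toNNReal_lt_of_lt_coe hL, _, hball, hlip⟩, fun x₀ y₀ hx hy ↦
    h.chartRep_of_chartRep hball hlip (mem_extChartAt_source p) (mem_extChartAt_source (F p)) hx hy⟩

variable [FiniteDimensional ℝ E] [FiniteDimensional ℝ E']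

theorem IsNonsingularPoint.convexlyExpandingAt {F : M → N} {K : ℝ≥0} (hF : LipschitzWith K F)
    (hdim : Module.finrank ℝ E ≤ Module.finrank ℝ E') {x : M}
    (hx : IsNonsingularPoint 𝓘(ℝ, E) 𝓘(ℝ, E') F x) :
    ConvexlyExpandingAt (chartRep E E' x (F x) F) (extChartAt 𝓘(ℝ, E) x x) := by
  obtain ⟨K', s, hs, hlip⟩ := exists_lipschitzOnWith_chartRep_of_mem_source univ_mem
    (lipschitzOnWith_univ.2 hF) (mem_extChartAt_source (I := 𝓘(ℝ, E)) x)
    (mem_extChartAt_source (I := 𝓘(ℝ, E')) (F x))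
  refine convexlyExpandingAt_of_injective hs hlip fun A hA ↦ ?_
  have hrank := hx A (convexHull_mono (limitingDerivatives_chartRep_subset hF.continuous x) hA)
  rw [min_eq_left hdim] at hrank
  have hker := LinearMap.finrank_range_add_finrank_ker (A : E →ₗ[ℝ] E')
  exact LinearMap.ker_eq_bot.1 (Submodule.finrank_eq_zero.1 (by lia))

theorem mainTheorem1_general [CompactSpace M] (hdim : Module.finrank ℝ E ≤ Module.finrank ℝ E')
    {F : M → N} (hF : ∃ K : ℝ≥0, LipschitzWith K F)
    (hns : ∀ x : M, IsNonsingularPoint 𝓘(ℝ, E) 𝓘(ℝ, E') F x) {η : ℝ} (hη : 0 < η) :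
    ∃ f : M → N,
      (ContMDiff 𝓘(ℝ, E) 𝓘(ℝ, E') ∞ f ∧
        ∀ x : M, Function.Injective (mfderiv 𝓘(ℝ, E) 𝓘(ℝ, E') f x)) ∧
      (∀ x : M, edist (F x) (f x) < ENNReal.ofReal η) ∧
      lipschitzConstant f ≤ lipschitzConstant F * ENNReal.ofReal (1 + η) := by
  obtain ⟨K, hK⟩ := hF
  have hη1 : 1 < ENNReal.ofReal (1 + η) := ENNReal.one_lt_ofReal.2 (by linarith)
  have hexp := fun x ↦ (hns x).convexlyExpandingAt hK hdim
  rcases eq_or_ne (lipschitzConstant F) 0 with hF0 | hF0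
  · have := discreteTopology_of_lipschitzConstant_eq_zero hF0 hexp
    have hsmooth : ContMDiff 𝓘(ℝ, E) 𝓘(ℝ, E') ∞ F := contMDiff_of_discreteTopology
    exact ⟨F, ⟨hsmooth, fun x ↦ (hexp x).mfderiv_injective (hsmooth.mdifferentiableAt (by simp))⟩,
      fun x ↦ by simpa using hη, by simp [hF0]⟩
  have hFtop : lipschitzConstant F ≠ ⊤ := ne_top_of_le_ne_top ENNReal.coe_ne_top
    (lipschitzConstant_le hK)
  obtain ⟨L, hL⟩ : ∃ L : ℝ≥0, (L : ℝ≥0∞) = lipschitzConstant F * ENNReal.ofReal (1 + η) :=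
    ⟨_, ENNReal.coe_toNNReal (ENNReal.mul_ne_top hFtop ENNReal.ofReal_ne_top)⟩
  have hFL : lipschitzConstant F < L := by
    rw [hL]
    simpa using ENNReal.mul_lt_mul_right hF0 hFtop hη1
  obtain ⟨f, hf, hFf, hsmooth⟩ := exists_contMDiff_isAdmissibleAt
    (fun p ↦ isAdmissibleAt_of_lipschitzConstant_lt hFL (hexp p)) (ENNReal.ofReal_pos.2 hη)
  refine ⟨f, ⟨hsmooth, fun x ↦ (hf x).mfderiv_injective (hsmooth.mdifferentiableAt (by simp))⟩,
    hFf, ?_⟩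
  rw [← hL]
  exact lipschitzConstant_le_of_isAdmissibleAt (ENNReal.coe_pos.1 (pos_of_gt hFL)) hf

end Nonsingular

section RiemannianBundle

variable {EB : Type*} [NormedAddCommGroup EB] [NormedSpace ℝ EB]
  {HB : Type*} [TopologicalSpace HB] (IB : ModelWithCorners ℝ EB HB) (n : ℕ∞ω)
  {B : Type*} [TopologicalSpace B] [ChartedSpace HB B]
  (F : Type*) [NormedAddCommGroup F] [NormedSpace ℝ F]
  (V : B → Type*) [TopologicalSpace (TotalSpace F V)] [∀ x, NormedAddCommGroup (V x)]
  [∀ x, InnerProductSpace ℝ (V x)] [FiberBundle F V] [VectorBundle ℝ F V]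

theorem isContinuousRiemannianBundle_of_isContMDiffRiemannianBundle
    [h : IsContMDiffRiemannianBundle IB n F V] : IsContinuousRiemannianBundle F V := by
  obtain ⟨g, hg, hg'⟩ := h.exists_contMDiff
  exact ⟨g, hg.continuous, hg'⟩

end RiemannianBundle

end

theorem mainTheorem1 {m n : ℕ} (hmn : m ≤ n)
    {M : Type*} [EMetricSpace M] [CompactSpace M]
    [ChartedSpace (EuclideanSpace ℝ (Fin m)) M] [IsManifold (𝓡 m) ∞ M]
    [RiemannianBundle (fun x : M ↦ TangentSpace (𝓡 m) x)]
    [IsContMDiffRiemannianBundle (𝓡 m) ∞ (EuclideanSpace ℝ (Fin m))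
      (fun x : M ↦ TangentSpace (𝓡 m) x)]
    [IsRiemannianManifold (𝓡 m) M]
    {N : Type*} [EMetricSpace N]
    [ChartedSpace (EuclideanSpace ℝ (Fin n)) N] [IsManifold (𝓡 n) ∞ N]
    [RiemannianBundle (fun y : N ↦ TangentSpace (𝓡 n) y)]
    [IsContMDiffRiemannianBundle (𝓡 n) ∞ (EuclideanSpace ℝ (Fin n))
      (fun y : N ↦ TangentSpace (𝓡 n) y)]
    [IsRiemannianManifold (𝓡 n) N]
    (F : M → N) (hF : ∃ K : ℝ≥0, LipschitzWith K F)
    (hns : ∀ x : M, IsNonsingularPoint (𝓡 m) (𝓡 n) F x)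
    (η : ℝ) (hη : 0 < η) :
    ∃ f : M → N,
      (ContMDiff (𝓡 m) (𝓡 n) ∞ f ∧
        ∀ x : M, Function.Injective (mfderiv (𝓡 m) (𝓡 n) f x)) ∧
      (∀ x : M, edist (F x) (f x) < ENNReal.ofReal η) ∧
      lipschitzConstant f ≤ lipschitzConstant F * ENNReal.ofReal (1 + η) := by
  have := isContinuousRiemannianBundle_of_isContMDiffRiemannianBundle (𝓡 m) ∞
    (EuclideanSpace ℝ (Fin m)) (fun x : M ↦ TangentSpace (𝓡 m) x)
  have := isContinuousRiemannianBundle_of_isContMDiffRiemannianBundle (𝓡 n) ∞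
    (EuclideanSpace ℝ (Fin n)) (fun y : N ↦ TangentSpace (𝓡 n) y)
  exact mainTheorem1_general (by simpa using hmn) hF hns hη
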